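/- **Setting.** A labelled graph $(G,x)$ is a finite simple connected graph $G$ with a bit string $x(v)\in\{0,1\}^*$ at every node; a distributed language is a set of labelled graphs. A local algorithm has a constant number $r$ of rounds and a computable map that sends the radius-$r$ neighbourhood of a node (its topology, and the inputs and identifiers of its nodes) to *yes* or *no*; the identifiers are arbitrary pairwise distinct natural numbers. It decides $L$ if for every labelled graph and every assignment of identifiers, $(G,x)\in L$ if and only if all nodes output *yes*. It is identifier-oblivious if the output of every node is the same for all assignments of identifiers. $\mathsf{LD}$ (resp. $\mathsf{LDO}$) is the class of languages decided by local (resp. identifier-oblivious local) algorithms. A scalar oracle $f$ gives for each $n\ge 1$ a list $f(n)=(f^{(n)}_1,\dots,f^{(n)}_n)$ of bit strings in non-decreasing order (shorter strings first, strings of equal length lexicographically; a number is compared through its binary numeral). $\mathsf{LDO}^f$ is the class of languages decided by an identifier-oblivious local algorithm when each node of an $n$-node graph also carries one of the labels of $f(n)$, and this for every one-to-one assignment of the $n$ labels to the nodes. The oracle $f$ is large if for every $c>0$ there is a $k\ge 1$ with $f^{(n)}_k\ge c$ for all $n\ge k$, and small otherwise. **Theorem 5.** Fix the effective enumeration of all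 Turing machines through their transition tables. Let $f(n)=(0,\dots,0,b_n)$, where $b_n$ is the $n$-bit string whose $i$-th bit tells whether the $i$-th Turing machine halts on the empty tape. Then $f$ is a small oracle, and: 1. $L_1\in\mathsf{LDO}^f\setminus\mathsf{LD}$, where $L_1=\{P(n) : n\ge 1,\ \text{the } n\text{-th Turing machine halts on the empty tape}\}$ and $P(n)$ is the path with $n$ nodes in which the input of each node is the pair of $n$ and the distance to a fixed end of the path; 2. there is a language $L_2\in(\mathsf{LD}\cap\mathsf{LDO}^f)\setminus\mathsf{LDO}$; 3. there is a language $L_3\in\mathsf{LD}\setminus\mathsf{LDO}^f$. Hence $\mathsf{LD}\not\subseteq\mathsf{LDO}^f$ and $\mathsf{LDO}^f\not\subseteq\mathsf{LD}$. -/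

import Mathlib

/-! ### Labelled graphs, views and local algorithms -/

/-- A finite simple connected graph with a label in `α` at every node.  Up to renaming the nodes,
every such graph has node set `Fin n`; connectedness includes `n ≥ 1`. -/
structure LabelledGraph (α : Type) where
  n : ℕ
  graph : SimpleGraph (Fin n)
  connected : graph.Connected
  label : Fin n → α

/-- A distributed language: a set of graphs labelled with bit strings. -/
abbrev DistributedLanguage : Type := Set (LabelledGraph (List Bool))

/-- The finite description of a neighbourhood: the identifier of the centre, and the list of the
nodes, each one with its identifier, its label and the identifiers of its neighbours. -/
abbrev View (α : Type) : Type := ℕ × List (ℕ × α × List ℕ)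

namespace LabelledGraph

open Classical in
/-- The nodes at distance at most `r` from `v`, in increasing order of their identifiers. -/
noncomputable def ball {α : Type} (G : LabelledGraph α) (ids : Fin G.n ↪ ℕ) (r : ℕ)
    (v : Fin G.n) : List (Fin G.n) :=
  ((List.finRange G.n).filter fun u => decide (G.graph.dist v u ≤ r)).mergeSort
    fun a b => decide (ids a ≤ ids b)

open Classical in
/-- What the node `v` knows after `r` rounds: the subgraph induced by its radius-`r`
neighbourhood, with all identifiers and labels.  Nodes are known by their identifiers only, so
isomorphic neighbourhoods (with the same identifiers and labels) have the same view. -/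
noncomputable def view {α : Type} (G : LabelledGraph α) (ids : Fin G.n ↪ ℕ) (r : ℕ)
    (v : Fin G.n) : View α :=
  (ids v, (G.ball ids r v).map fun u =>
    (ids u, G.label u, ((G.ball ids r v).filter fun w => decide (G.graph.Adj u w)).map ids))

end LabelledGraph

/-- A constant-time algorithm of the LOCAL model for a decision task: a number of rounds and a
computable map from neighbourhoods to outputs (`true` is *yes*, `false` is *no*). -/
structure LocalAlgorithm (α : Type) [Primcodable α] where
  radius : ℕ
  out : View α → Bool
  computable : Computable out

namespace LocalAlgorithm

/-- All nodes output *yes*. -/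
def Accepts {α : Type} [Primcodable α] (A : LocalAlgorithm α) (G : LabelledGraph α)
    (ids : Fin G.n ↪ ℕ) : Prop :=
  ∀ v : Fin G.n, A.out (G.view ids A.radius v) = true

/-- The output of every node is the same for all assignments of identifiers. -/
def IdentifierOblivious {α : Type} [Primcodable α] (A : LocalAlgorithm α) : Prop :=
  ∀ (G : LabelledGraph α) (ids ids' : Fin G.n ↪ ℕ) (v : Fin G.n),
    A.out (G.view ids A.radius v) = A.out (G.view ids' A.radius v)

/-- `A` decides `L`: on every instance, and for every assignment of identifiers, the instance
belongs to `L` if and only if all nodes output *yes*. -/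
def Decides (A : LocalAlgorithm (List Bool)) (L : DistributedLanguage) : Prop :=
  ∀ (G : LabelledGraph (List Bool)) (ids : Fin G.n ↪ ℕ), G ∈ L ↔ A.Accepts G ids

end LocalAlgorithm

/-- `LD`: the languages decided by a local algorithm. -/
def LD : Set DistributedLanguage :=
  {L | ∃ A : LocalAlgorithm (List Bool), A.Decides L}

/-- `LDO`: the languages decided by an identifier-oblivious local algorithm. -/
def LDO : Set DistributedLanguage :=
  {L | ∃ A : LocalAlgorithm (List Bool), A.IdentifierOblivious ∧ A.Decides L}

/-! ### Scalar oracles -/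

/-- The order of bit strings: shorter strings first, strings of equal length lexicographically.
On binary numerals it is the order of the numbers. -/
def BitLE (s t : List Bool) : Prop := s = t ∨ List.Shortlex (· < ·) s t

/-- The binary numeral of `c`, most significant bit first. -/
def binaryNumeral (c : ℕ) : List Bool := if c = 0 then [false] else c.bits.reverse

/-- A scalar oracle: for every `n`, a list of `n` bit strings in non-decreasing order.  The
`k`-th label on `n` nodes is `label n ⟨k - 1, _⟩`. -/
structure ScalarOracle where
  label : (n : ℕ) → Fin n → List Bool
  sorted : ∀ (n : ℕ) (i j : Fin n), i ≤ j → BitLE (label n i) (label n j)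

namespace ScalarOracle

/-- `∀ c > 0, ∃ k ≥ 1, ∀ n ≥ k`, the `k`-th label on `n` nodes is at least `c`
(with `k + 1` in place of `k`). -/
def Large (f : ScalarOracle) : Prop :=
  ∀ c : ℕ, 0 < c → ∃ k : ℕ, ∀ (n : ℕ) (h : k + 1 ≤ n), BitLE (binaryNumeral c) (f.label n ⟨k, h⟩)

def Small (f : ScalarOracle) : Prop := ¬ f.Large

end ScalarOracle

/-- The network in which node `v` has, besides its input, the oracle label number `π v`. -/
def LabelledGraph.withOracle (G : LabelledGraph (List Bool)) (f : ScalarOracle)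
    (π : Equiv.Perm (Fin G.n)) : LabelledGraph (List Bool × List Bool) where
  n := G.n
  graph := G.graph
  connected := G.connected
  label v := (G.label v, f.label G.n (π v))

/-- `A` decides `L` in networks labelled with the oracle `f`, whatever the one-to-one assignment
of the oracle labels to the nodes is. -/
def LocalAlgorithm.DecidesWith (A : LocalAlgorithm (List Bool × List Bool)) (f : ScalarOracle)
    (L : DistributedLanguage) : Prop :=
  ∀ (G : LabelledGraph (List Bool)) (π : Equiv.Perm (Fin G.n)) (ids : Fin G.n ↪ ℕ),
    G ∈ L ↔ A.Accepts (G.withOracle f π) ids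

/-- `LDO^f`: the languages decided by an identifier-oblivious local algorithm in networks labelled
with the oracle `f`. -/
def LDOWith (f : ScalarOracle) : Set DistributedLanguage :=
  {L | ∃ A : LocalAlgorithm (List Bool × List Bool), A.IdentifierOblivious ∧ A.DecidesWith f L}

/-! ### Turing machines and their enumeration -/

/-- The transition table of a Turing machine whose states and tape symbols are natural numbers
(finitely many of them occur).  An entry `((q, a), (q', s))` says: in state `q`, reading `a`, go
to state `q'` and perform the action number `s`. -/
abbrev TMTable : Type := List ((ℕ × ℕ) × (ℕ × ℕ))

/-- The actions: `0` moves left, `1` moves right, `a + 2` writes the symbol `a`. -/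
def tmAction : ℕ → Turing.TM0.Stmt ℕ
  | 0 => Turing.TM0.Stmt.move Turing.Dir.left
  | 1 => Turing.TM0.Stmt.move Turing.Dir.right
  | a + 2 => Turing.TM0.Stmt.write a

/-- The machine of a transition table (the first entry for `(q, a)` counts).  It halts where the
table has no entry; the initial state and the blank symbol are `0`. -/
def TMTable.machine (T : TMTable) : Turing.TM0.Machine ℕ ℕ :=
  fun q a => (T.lookup (q, a)).map fun p => (p.1, tmAction p.2)

/-- The effective enumeration of all Turing machines, counted from `0`: the machine number
`i + 1` is `turingMachine i`. -/
def turingMachine (i : ℕ) : TMTable := Denumerable.ofNat TMTable i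

/-- The machine halts when it is started on the empty tape. -/
def TMTable.Halts (T : TMTable) : Prop := (Turing.TM0.eval T.machine []).Dom

open Classical in
/-- The `n`-bit string whose `i`-th bit tells whether the `i`-th Turing machine halts,
`i = 1, …, n`. -/
noncomputable def haltingBits (n : ℕ) : List Bool :=
  List.ofFn fun i : Fin n => decide (turingMachine i).Halts

/-- The oracle `f(n) = (0, …, 0, b_n)` with `b_n = haltingBits n`. -/
noncomputable def haltingOracle : ScalarOracle where
  label n i := if (i : ℕ) + 1 = n then haltingBits n else [false]
  sorted := by
    intro n i j hij
    rcases eq_or_lt_of_le hij with rfl | hlt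
    · exact Or.inl rfl
    · have hi : ¬ (i : ℕ) + 1 = n := by have := j.isLt; have : (i : ℕ) < j := hlt; omega
      rw [if_neg hi]
      split_ifs with hj
      · right
        apply List.Shortlex.of_length_lt
        have : (i : ℕ) < j := hlt
        simp [haltingBits]
        omega
      · exact Or.inl rfl

/-! ### Halting on paths -/

/-- The bit string `1^n 0 1^d` for a pair `(n, d)`. -/
def pairLabel (n d : ℕ) : List Bool := List.replicate n true ++ false :: List.replicate d true

/-- The labelled paths `P(n)` for which the `n`-th Turing machine halts.  The path `P(n)` has `n`
nodes; the input of a node is the pair of `n` and its distance to a specified end of the path. -/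
def haltingPaths : DistributedLanguage :=
  {G | ∃ i : ℕ, G.n = i + 1 ∧ (turingMachine i).Halts ∧
    ∃ e : G.graph ≃g SimpleGraph.pathGraph G.n, ∀ v, G.label v = pairLabel G.n (e v)}

/-! ### Balls, views and isomorphic neighbourhoods -/

namespace LabelledGraph

variable {α : Type}

/-! The oracle helps a single node: the holder of `b_n` learns `n` from its length and the halting
behaviour of the first `n` machines from its bits. All other labels are `0`, so the oracle is small.

For `L₁`, local checks force a path whose labels contain its true size `n`
(`injective_of_locally_path`, `exists_card_eq_of_injective`), and the holder of `b_n` reads the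
answer in the last bit. Identifiers are no substitute: if they are the positions on the path, every
view of `P(n)` is computable from `n` and the position (`labelledPath_view`), so a local decider
would decide halting on the empty tape. For the given enumeration this is impossible
(`not_computable_halts`): a program `m` is turned computably into a table that first writes an
encoding of `m` and then simulates a fixed machine.

`L₂` and `L₃` consist of locally grid-like graphs carrying a program `N`, a depth `r` and a flag.
Only row `0` knows the columns, only the rows from `r` on know the flag, and the end of row `0`
certifies that `N` halts within `W - 1` steps, `W` being the number of columns. Excluded is the case
that the flag is `1` and `N` outputs `1`. To detect this case it suffices that a node aware of the
flag has a number at least `W - 1` as a time bound. Identifiers provide one: at least `W` nodes lie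
in the rows from `r` on, so one of them has an identifier at least `W - 1`.

An oblivious algorithm fails (`not_oblivious_grid`). For `r = 2 * radius + 1`, nodes near the top
never see row `0`, and their views already occur in a grid of constant width that is computable from
`N`; the other nodes do not see the flag. Running the algorithm on the small grid would computably
separate the programs with output `1` from those with output `0`, against the recursion theorem
(`not_computable_separating`).

The two languages differ in what the size of the graph reveals. In `L₂` the flag `1` adds a row. As
`W` is `1` modulo `r + 1`, the size is `1` modulo `r + 1` with the extra row and `0` without it; so
the holder of `b_n` infers the flag and uses `n ≥ W` as a time bound. In `L₃` the size is `W * (r +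
1)` for every flag, and an adversary puts `b_n` in a corner of row `0`: the oracle reveals nothing
about the flag there and is invisible from the top. -/

theorem mem_ball (G : LabelledGraph α) (ids : Fin G.n ↪ ℕ) (r : ℕ) (v u : Fin G.n) :
    u ∈ G.ball ids r v ↔ G.graph.dist v u ≤ r := by
  classical
  simp [ball]

theorem nodup_ball (G : LabelledGraph α) (ids : Fin G.n ↪ ℕ) (r : ℕ) (v : Fin G.n) :
    (G.ball ids r v).Nodup := by
  classical
  unfold ball
  exact (List.mergeSort_perm _ _).nodup_iff.2 ((List.nodup_finRange _).filter _)

theorem pairwise_ball (G : LabelledGraph α) (ids : Fin G.n ↪ ℕ) (r : ℕ) (v : Fin G.n) :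
    (G.ball ids r v).Pairwise fun a b => ids a ≤ ids b := by
  classical
  unfold ball
  have := List.pairwise_mergeSort (le := fun a b : Fin G.n => decide (ids a ≤ ids b))
    (fun a b c h1 h2 => by simp at *; omega) (fun a b => by simp; omega)
    ((List.finRange G.n).filter fun u => decide (G.graph.dist v u ≤ r))
  simpa using this

/-- A walk of length at most `k + 1` ends at its start or at a neighbour of a node at distance at
most `k`. -/
theorem exists_adj_of_dist_le_succ (G : LabelledGraph α) {v u : Fin G.n} {k : ℕ}
    (h : G.graph.dist v u ≤ k + 1) :
    u = v ∨ ∃ w, G.graph.dist v w ≤ k ∧ G.graph.Adj w u := by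
  obtain ⟨p, hp⟩ := G.connected.exists_walk_length_eq_dist v u
  rcases hq : p.reverse with _ | ⟨hadj, q⟩
  · left; rfl
  · right
    rename_i w
    refine ⟨w, ?_, hadj.symm⟩
    have h1 := SimpleGraph.dist_le q.reverse
    have h2 : p.reverse.length = q.length + 1 := by rw [hq]; simp
    simp at h1 h2
    omega

theorem dist_le_succ_of_adj (G : LabelledGraph α) {v w u : Fin G.n} {k : ℕ}
    (h : G.graph.dist v w ≤ k) (hw : G.graph.Adj w u) : G.graph.dist v u ≤ k + 1 := by
  have := G.connected.dist_triangle (u := v) (v := w) (w := u)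
  have := SimpleGraph.dist_eq_one_iff_adj.2 hw
  omega

/-- A partial isomorphism between the neighbourhoods of two nodes, given as a relation. -/
structure BallIso (G G' : LabelledGraph α) (r : ℕ) (v : Fin G.n) (v' : Fin G'.n)
    (E : Fin G.n → Fin G'.n → Prop) : Prop where
  base : E v v'
  unique : ∀ {u u' u''}, E u u' → E u u'' → u' = u''
  inj : ∀ {u w u'}, E u u' → E w u' → u = w
  adj : ∀ {u u' w w'}, E u u' → E w w' → (G.graph.Adj u w ↔ G'.graph.Adj u' w')
  label : ∀ {u u'}, E u u' → G.label u = G'.label u'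
  total : ∀ u, G.graph.dist v u ≤ r → ∃ u', E u u'
  surj : ∀ u', G'.graph.dist v' u' ≤ r → ∃ u, E u u'

namespace BallIso

variable {G G' : LabelledGraph α} {r : ℕ} {v : Fin G.n} {v' : Fin G'.n}
  {E : Fin G.n → Fin G'.n → Prop}

theorem symm (h : BallIso G G' r v v' E) : BallIso G' G r v' v fun a b => E b a where
  base := h.base
  unique h1 h2 := h.inj h1 h2
  inj h1 h2 := h.unique h1 h2
  adj h1 h2 := (h.adj h1 h2).symm
  label h1 := (h.label h1).symm
  total := h.surj
  surj := h.total

/-- A shortest walk from the centre stays in the ball, where `E` is defined and preserves adjacency,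
so it is carried over step by step. The domain of `E` may be larger than the ball. -/
theorem dist_le (h : BallIso G G' r v v' E) {k : ℕ} (hk : k ≤ r) {u : Fin G.n} {u' : Fin G'.n}
    (hE : E u u') (hd : G.graph.dist v u ≤ k) : G'.graph.dist v' u' ≤ k := by
  induction k generalizing u u' with
  | zero =>
    have : v = u := by
      have := (G.connected.dist_eq_zero_iff (u := v) (v := u)).1 (by omega)
      exact this
    subst this
    rw [h.unique hE h.base]
    simp
  | succ k ih =>
    rcases G.exists_adj_of_dist_le_succ hd with rfl | ⟨w, hw, hwu⟩
    · rw [h.unique hE h.base]; simp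
    · obtain ⟨w', hw'⟩ := h.total w (by omega)
      exact G'.dist_le_succ_of_adj (ih (by omega) hw' hw) ((h.adj hw' hE).1 hwu)

theorem dist_le_iff (h : BallIso G G' r v v' E) {u : Fin G.n} {u' : Fin G'.n}
    (hE : E u u') : G.graph.dist v u ≤ r ↔ G'.graph.dist v' u' ≤ r :=
  ⟨h.dist_le le_rfl hE, h.symm.dist_le le_rfl hE⟩

/-- Isomorphic neighbourhoods have the same view for suitable identifiers. -/
theorem exists_view_eq (h : BallIso G G' r v v' E) :
    ∃ (ids : Fin G.n ↪ ℕ) (ids' : Fin G'.n ↪ ℕ), G.view ids r v = G'.view ids' r v' := by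
  classical
  let ids' : Fin G'.n ↪ ℕ := Fin.valEmbedding
  -- The identifiers of `G'` are pulled back along `E`; the shift by `G'.n` keeps those outside the
  -- domain of `E` distinct from them.
  let f : Fin G.n → ℕ := fun u => if hu : ∃ u', E u u' then (hu.choose : ℕ) else G'.n + u
  have hf : ∀ {u u'}, E u u' → f u = u' := by
    intro u u' hE
    have hu : ∃ u', E u u' := ⟨u', hE⟩
    simp only [f, dif_pos hu]
    rw [h.unique hu.choose_spec hE]
  have hf' : ∀ {u}, (¬ ∃ u', E u u') → f u = G'.n + u := fun hu => by simp only [f, dif_neg hu]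
  have hinj : Function.Injective f := by
    intro u w huw
    by_cases hu : ∃ u', E u u' <;> by_cases hw : ∃ w', E w w'
    · obtain ⟨u', hu⟩ := hu
      obtain ⟨w', hw⟩ := hw
      rw [hf hu, hf hw] at huw
      obtain rfl := Fin.ext huw
      exact h.inj hu hw
    · obtain ⟨u', hu⟩ := hu
      rw [hf hu, hf' hw] at huw; omega
    · obtain ⟨w', hw⟩ := hw
      rw [hf hw, hf' hu] at huw; omega
    · rw [hf' hu, hf' hw] at huw
      exact Fin.ext (by omega)
  let ids : Fin G.n ↪ ℕ := ⟨f, hinj⟩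
  let e : Fin G.n → Fin G'.n := fun u => if hu : ∃ u', E u u' then hu.choose else v'
  have he : ∀ {u u'}, E u u' → e u = u' := by
    intro u u' hE
    have hu : ∃ u', E u u' := ⟨u', hE⟩
    simp only [e, dif_pos hu]
    exact h.unique hu.choose_spec hE
  have hE : ∀ u ∈ G.ball ids r v, E u (e u) := by
    intro u hu
    obtain ⟨u', hu'⟩ := h.total u ((mem_ball ..).1 hu)
    rwa [he hu']
  have hids : ∀ u ∈ G.ball ids r v, ids u = ids' (e u) := fun u hu => hf (hE u hu)
  have hball : G'.ball ids' r v' = (G.ball ids r v).map e := by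
    have hn : ((G.ball ids r v).map e).Nodup :=
      List.Nodup.map_on (fun x hx y hy hxy => h.inj (hE x hx) (hxy ▸ hE y hy)) (nodup_ball ..)
    have hperm : (G'.ball ids' r v').Perm ((G.ball ids r v).map e) := by
      refine (List.perm_ext_iff_of_nodup (nodup_ball ..) hn).2 fun u' => ?_
      rw [List.mem_map, mem_ball]
      constructor
      · intro hd
        obtain ⟨u, hu⟩ := h.surj u' hd
        exact ⟨u, (mem_ball ..).2 ((h.dist_le_iff hu).2 hd), he hu⟩
      · rintro ⟨u, hu, rfl⟩
        exact (h.dist_le_iff (hE u hu)).1 ((mem_ball ..).1 hu)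
    -- Both lists are sorted by identifiers and are permutations of each other, so they are equal.
    refine List.Perm.eq_of_pairwise (le := fun a b => ids' a ≤ ids' b) ?_ (pairwise_ball ..) ?_ hperm
    · intro a b _ _ h1 h2
      exact ids'.injective (le_antisymm h1 h2)
    · rw [List.pairwise_map]
      refine List.Pairwise.imp_of_mem ?_ (pairwise_ball G ids r v)
      intro a b ha hb hab
      rwa [← hids a ha, ← hids b hb]
  refine ⟨ids, ids', ?_⟩
  unfold view
  have hv : v ∈ G.ball ids r v := (mem_ball ..).2 (by simp)
  refine Prod.ext ?_ ?_
  · change ids v = ids' v'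
    rw [hids v hv, he h.base]
  · change List.map _ (G.ball ids r v) = List.map _ (G'.ball ids' r v')
    rw [hball, List.map_map]
    refine List.map_congr_left fun u hu => ?_
    simp only [Function.comp]
    rw [← hids u hu, ← h.label (hE u hu), List.filter_map, List.map_map]
    congr 2
    have : List.filter ((fun w => decide (G'.graph.Adj (e u) w)) ∘ e) (G.ball ids r v)
        = List.filter (fun w => decide (G.graph.Adj u w)) (G.ball ids r v) := by
      refine List.filter_congr fun w hw => ?_
      simp only [Function.comp]
      rw [decide_eq_decide]
      exact (h.adj (hE u hu) (hE w hw)).symm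
    rw [this]
    refine List.map_congr_left fun w hw => ?_
    exact hids w (List.mem_of_mem_filter hw)

/-- Obliviousness replaces the given identifiers by those that make the two views literally equal.
-/
theorem out_eq [Primcodable α] {A : LocalAlgorithm α} (hA : A.IdentifierOblivious)
    {E : Fin G.n → Fin G'.n → Prop}
    (h : BallIso G G' A.radius v v' E) (i : Fin G.n ↪ ℕ) (i' : Fin G'.n ↪ ℕ) :
    A.out (G.view i A.radius v) = A.out (G'.view i' A.radius v') := by
  obtain ⟨ids, ids', he⟩ := h.exists_view_eq
  rw [hA G i ids v, hA G' i' ids' v', he]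

end BallIso

end LabelledGraph

/-! ### Reading a view -/

/-- The description of one node in a view. -/
abbrev ViewEntry (α : Type) : Type := ℕ × α × List ℕ

namespace View

variable {α : Type}

/-- The entries of the centre. -/
def center (V : View α) : List (ViewEntry α) := V.2.filter fun x => x.1 = V.1

/-- The entries of the neighbours of `x` in the view. -/
def nbrs (V : View α) (x : ViewEntry α) : List (ViewEntry α) := V.2.filter fun y => y.1 ∈ x.2.2

end View

namespace LabelledGraph

variable {α : Type}

open Classical in
/-- The entry of the node `u` in the view of the node `v`. -/
noncomputable def entry (G : LabelledGraph α) (ids : Fin G.n ↪ ℕ) (r : ℕ) (v u : Fin G.n) :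
    ViewEntry α :=
  (ids u, G.label u, ((G.ball ids r v).filter fun w => decide (G.graph.Adj u w)).map ids)

variable (G : LabelledGraph α) (ids : Fin G.n ↪ ℕ) (r : ℕ) (v : Fin G.n)

theorem mem_view_snd {x : ViewEntry α} :
    x ∈ (G.view ids r v).2 ↔ ∃ u, G.graph.dist v u ≤ r ∧ G.entry ids r v u = x := by
  unfold view
  simp only [List.mem_map, mem_ball]
  rfl

theorem mem_center {x : ViewEntry α} :
    x ∈ View.center (G.view ids r v) ↔ x = G.entry ids r v v := by
  unfold View.center
  simp only [List.mem_filter, mem_view_snd, decide_eq_true_eq]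
  constructor
  · rintro ⟨⟨u, _, rfl⟩, hu⟩
    have : u = v := ids.injective hu
    rw [this]
  · rintro rfl
    exact ⟨⟨v, by simp, rfl⟩, rfl⟩

theorem entry_adj {u w : Fin G.n} (hw : G.graph.dist v w ≤ r) :
    (G.entry ids r v w).1 ∈ (G.entry ids r v u).2.2 ↔ G.graph.Adj u w := by
  classical
  unfold entry
  simp [mem_ball, hw]

/-- A view lists only those neighbours that lie in the ball; the hypothesis `hu` puts every
neighbour of `u` there. -/
theorem mem_nbrs {u : Fin G.n} (hu : G.graph.dist v u + 1 ≤ r) {x : ViewEntry α} :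
    x ∈ View.nbrs (G.view ids r v) (G.entry ids r v u) ↔
      ∃ w, G.graph.Adj u w ∧ G.entry ids r v w = x := by
  unfold View.nbrs
  simp only [List.mem_filter, mem_view_snd, decide_eq_true_eq]
  constructor
  · rintro ⟨⟨w, hw, rfl⟩, h⟩
    exact ⟨w, (G.entry_adj ids r v hw).1 h, rfl⟩
  · rintro ⟨w, hw, rfl⟩
    have hd : G.graph.dist v w ≤ r := le_trans (G.dist_le_succ_of_adj le_rfl hw) hu
    exact ⟨⟨w, hd, rfl⟩, (G.entry_adj ids r v hd).2 hw⟩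

theorem forall_center {P : ViewEntry α → Prop} :
    (∀ x ∈ View.center (G.view ids r v), P x) ↔ P (G.entry ids r v v) := by
  simp [mem_center]

theorem forall_nbrs {u : Fin G.n} (hu : G.graph.dist v u + 1 ≤ r) {P : ViewEntry α → Prop} :
    (∀ x ∈ View.nbrs (G.view ids r v) (G.entry ids r v u), P x) ↔
      ∀ w, G.graph.Adj u w → P (G.entry ids r v w) := by
  simp only [G.mem_nbrs ids r v hu]
  constructor
  · intro h w hw
    exact h _ ⟨w, hw, rfl⟩
  · rintro h _ ⟨w, hw, rfl⟩
    exact h w hw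

theorem exists_nbrs {u : Fin G.n} (hu : G.graph.dist v u + 1 ≤ r) {P : ViewEntry α → Prop} :
    (∃ x ∈ View.nbrs (G.view ids r v) (G.entry ids r v u), P x) ↔
      ∃ w, G.graph.Adj u w ∧ P (G.entry ids r v w) := by
  simp only [G.mem_nbrs ids r v hu]
  constructor
  · rintro ⟨_, ⟨w, hw, rfl⟩, h⟩
    exact ⟨w, hw, h⟩
  · rintro ⟨w, hw, h⟩
    exact ⟨_, ⟨w, hw, rfl⟩, h⟩

theorem entry_label (u : Fin G.n) : (G.entry ids r v u).2.1 = G.label u := rfl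

theorem entry_fst_eq {u w : Fin G.n} :
    (G.entry ids r v u).1 = (G.entry ids r v w).1 ↔ u = w :=
  ids.injective.eq_iff

end LabelledGraph

/-! ### Primitive recursive predicates -/

namespace PrimrecPred

variable {γ δ : Type} [Primcodable γ] [Primcodable δ]

theorem forall_mem {f : γ → List δ} {P : γ → δ → Prop} (hf : Primrec f)
    (hP : PrimrecPred fun z : γ × δ => P z.1 z.2) : PrimrecPred fun c => ∀ y ∈ f c, P c y := by
  have h : PrimrecRel fun (a : δ) (b : γ) => P b a :=
    PrimrecPred.comp (f := fun z : δ × γ => (z.2, z.1)) hP (Primrec.pair Primrec.snd Primrec.fst)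
  exact PrimrecRel.comp h.forall_mem_list hf Primrec.id

theorem exists_mem {f : γ → List δ} {P : γ → δ → Prop} (hf : Primrec f)
    (hP : PrimrecPred fun z : γ × δ => P z.1 z.2) : PrimrecPred fun c => ∃ y ∈ f c, P c y := by
  have h : PrimrecRel fun (a : δ) (b : γ) => P b a :=
    PrimrecPred.comp (f := fun z : δ × γ => (z.2, z.1)) hP (Primrec.pair Primrec.snd Primrec.fst)
  exact PrimrecRel.comp h.exists_mem_list hf Primrec.id

theorem imp {p q : γ → Prop} (hp : PrimrecPred p) (hq : PrimrecPred q) :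
    PrimrecPred fun c => p c → q c := by
  refine (hp.not.or hq).of_eq fun c => ?_
  tauto

theorem mem {f : γ → δ} {g : γ → List δ} (hf : Primrec f) (hg : Primrec g) :
    PrimrecPred fun c => f c ∈ g c := by
  classical
  refine (exists_mem (P := fun c y => y = f c) hg
    (Primrec.eq.comp Primrec.snd (hf.comp Primrec.fst))).of_eq fun c => ?_
  simp

theorem const (p : Prop) : PrimrecPred fun _ : γ => p := by
  classical
  by_cases h : p
  · exact ⟨fun _ => isTrue h, (Primrec.const true).of_eq fun _ => by simp [h]⟩
  · exact ⟨fun _ => isFalse h, (Primrec.const false).of_eq fun _ => by simp [h]⟩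

theorem primrec_filter {f : γ → List δ} {P : γ → δ → Prop} [∀ c, DecidablePred (P c)]
    (hf : Primrec f) (hP : PrimrecPred fun z : γ × δ => P z.1 z.2) :
    Primrec fun c => (f c).filter fun y => decide (P c y) := by
  classical
  have hite : Primrec fun z : γ × δ => if P z.1 z.2 then some z.2 else none :=
    Primrec.ite hP (Primrec.option_some.comp Primrec.snd) (Primrec.const none)
  refine (Primrec.listFilterMap hf (g := fun c y => if P c y then some y else none)
    hite.to₂).of_eq fun c => ?_
  rw [← List.filterMap_eq_filter]
  congr 1
  funext y
  by_cases h : P c y <;> simp [h, Option.guard]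

/-- The Boolean function of a predicate, for any choice of the decision procedure. -/
theorem computable_decide {p : γ → Prop} (hp : PrimrecPred p) [DecidablePred p] :
    Computable fun c => decide (p c) := by
  obtain ⟨_, h⟩ := hp
  exact (h.of_eq fun c => by congr).to_comp

end PrimrecPred

namespace View

variable {α : Type} [Primcodable α]

theorem primrec_center : Primrec (center : View α → List (ViewEntry α)) :=
  PrimrecPred.primrec_filter (P := fun (V : View α) (x : ViewEntry α) => x.1 = V.1) Primrec.snd
    (Primrec.eq.comp (Primrec.fst.comp Primrec.snd) (Primrec.fst.comp Primrec.fst))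

theorem primrec_nbrs : Primrec₂ (nbrs : View α → ViewEntry α → List (ViewEntry α)) :=
  PrimrecPred.primrec_filter
    (P := fun (z : View α × ViewEntry α) (y : ViewEntry α) => y.1 ∈ z.2.2.2)
    (Primrec.snd.comp Primrec.fst)
    (PrimrecPred.mem (Primrec.fst.comp Primrec.snd)
      (Primrec.snd.comp (Primrec.snd.comp (Primrec.snd.comp Primrec.fst))))

end View

/-! ### Locally path-like relations -/

open Relation in
/-- A connected relation with a labelling that looks like a path locally is a path. -/
theorem injective_of_locally_path {X : Type*} {R : X → X → Prop} {f : X → ℕ}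
    (conn : ∀ x y, ReflTransGen R x y)
    (symm : ∀ x y, R x y → R y x)
    (step : ∀ x y, R x y → f y = f x + 1 ∨ f x = f y + 1)
    (uniq : ∀ x y y', R x y → R x y' → f y = f y' → y = y')
    (low : ∀ x, 0 < f x → ∃ y, R x y ∧ f y + 1 = f x) : Function.Injective f := by
  intro a b hab
  obtain ⟨x₀, hx₀⟩ : ∃ x₀, f x₀ = 0 := by
    have : ∀ k x, f x = k → ∃ x₀, f x₀ = 0 := by
      intro k
      induction k with
      | zero => exact fun x hx => ⟨x, hx⟩
      | succ k ih =>
        intro x hx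
        obtain ⟨y, _, hy⟩ := low x (by omega)
        exact ih y (by omega)
    exact this _ a rfl
  let up : X → X → Prop := fun x y => R x y ∧ f y = f x + 1
  -- A walk from `x₀` reduces to an ascending one: by uniqueness, a descending step undoes the last
  -- ascending step.
  have hup : ∀ x, ReflTransGen up x₀ x := by
    intro x
    induction conn x₀ x with
    | refl => exact .refl
    | @tail y z _ hyz ih =>
      rcases step _ _ hyz with h | h
      · exact ih.tail ⟨hyz, h⟩
      · rcases ih.cases_tail with h0 | ⟨w, hw, hwy⟩
        · subst h0; omega
        · rwa [uniq y z w hyz (symm _ _ hwy.1) (by have := hwy.2; omega)]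
  have hmono : ∀ {x y}, ReflTransGen up x y → f x = f y → x = y := by
    have hle : ∀ {x y}, ReflTransGen up x y → f x ≤ f y := by
      intro x y h
      induction h with
      | refl => exact le_rfl
      | tail _ h ih => have := h.2; omega
    intro x y h hf
    rcases h.cases_head with h | ⟨z, hz, hzy⟩
    · exact h
    · have := hle hzy
      have := hz.2
      omega
  -- Ascending is a partial function, so of two nodes reached from `x₀` one is reached from the
  -- other; equal values then leave no step between them.
  have hru : Relator.RightUnique up := fun x y z hy hz =>
    uniq x y z hy.1 hz.1 (by rw [hy.2, hz.2])
  rcases ReflTransGen.total_of_right_unique hru (hup a) (hup b) with h | h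
  · exact hmono h hab
  · exact (hmono h hab.symm).symm

/-- A down-closed injective labelling of a nonempty finite type takes the values below its
cardinality. -/
theorem exists_card_eq_of_injective {X : Type*} [Fintype X] [Nonempty X] {f : X → ℕ}
    (inj : Function.Injective f) (low : ∀ x, 0 < f x → ∃ y, f y + 1 = f x) :
    ∃ x, (∀ y, f y ≤ f x) ∧ Fintype.card X = f x + 1 := by
  classical
  obtain ⟨x, -, hx⟩ := Finset.exists_max_image (Finset.univ : Finset X) f Finset.univ_nonempty
  refine ⟨x, fun y => hx y (Finset.mem_univ y), ?_⟩
  -- The subtraction is truncated: once the value `0` is reached, the same node serves for all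
  -- larger `j`.
  have hdown : ∀ j, ∃ y, f y = f x - j := by
    intro j
    induction j with
    | zero => exact ⟨x, rfl⟩
    | succ j ih =>
      obtain ⟨y, hy⟩ := ih
      by_cases h : 0 < f y
      · obtain ⟨z, hz⟩ := low y h
        exact ⟨z, by omega⟩
      · exact ⟨y, by omega⟩
  have himg : Finset.univ.image f = Finset.range (f x + 1) := by
    ext k
    simp only [Finset.mem_image, Finset.mem_univ, true_and, Finset.mem_range]
    constructor
    · rintro ⟨y, rfl⟩
      have := hx y (Finset.mem_univ y)
      omega
    · intro hk
      obtain ⟨y, hy⟩ := hdown (f x - k)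
      exact ⟨y, by omega⟩
  rw [← Finset.card_univ, ← Finset.card_image_of_injective _ inj, himg, Finset.card_range]

theorem SimpleGraph.Connected.reflTransGen {V : Type*} {G : SimpleGraph V} (h : G.Connected)
    (x y : V) : Relation.ReflTransGen G.Adj x y :=
  (SimpleGraph.reachable_iff_reflTransGen x y).1 (h.preconnected x y)

/-! ### The oracle -/

theorem haltingOracle_label_of_lt {n : ℕ} {i : Fin n} (h : (i : ℕ) + 1 ≠ n) :
    haltingOracle.label n i = [false] := by
  simp [haltingOracle, h]

theorem haltingOracle_label_of_eq {n : ℕ} {i : Fin n} (h : (i : ℕ) + 1 = n) :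
    haltingOracle.label n i = haltingBits n := by
  simp [haltingOracle, h]

theorem length_haltingBits (n : ℕ) : (haltingBits n).length = n := by simp [haltingBits]

theorem haltingBits_getElem? (n : ℕ) :
    (haltingBits (n + 1))[n]? = some true ↔ (turingMachine n).Halts := by
  simp [haltingBits, -List.ofFn_succ]

/-- Already `c = 1` fails: at any fixed position, a list that is one entry longer still has the
label `0`. -/
theorem haltingOracle_small : haltingOracle.Small := by
  intro h
  obtain ⟨k, hk⟩ := h 1 one_pos
  have := hk (k + 2) (by omega)
  rw [haltingOracle_label_of_lt (by simp)] at this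
  rcases this with h | h
  · simp [binaryNumeral] at h
  · rw [List.shortlex_def] at h
    simp [binaryNumeral] at h
    exact absurd h (by decide)

/-- Some node has the last oracle label. -/
theorem exists_perm_eq_last {n : ℕ} (hn : 0 < n) (π : Equiv.Perm (Fin n)) :
    ∃ v, (π v : ℕ) + 1 = n :=
  ⟨π.symm ⟨n - 1, by omega⟩, by simp; omega⟩

namespace LabelledGraph

theorem n_pos {α : Type} (G : LabelledGraph α) : 0 < G.n := by
  obtain ⟨v⟩ := G.connected.nonempty
  exact v.pos

end LabelledGraph

/-! ### Decoding the labels of paths -/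

/-- The first component of a pair label. -/
def pairFst (x : List Bool) : ℕ := x.idxOf false

/-- The second component of a pair label. -/
def pairSnd (x : List Bool) : ℕ := x.length - pairFst x - 1

theorem pairFst_pairLabel (n d : ℕ) : pairFst (pairLabel n d) = n := by
  unfold pairFst pairLabel
  rw [List.idxOf_append_of_notMem (by simp)]
  simp

theorem pairSnd_pairLabel (n d : ℕ) : pairSnd (pairLabel n d) = d := by
  unfold pairSnd
  rw [pairFst_pairLabel]
  simp [pairLabel]

theorem primrec_pairFst : Primrec pairFst :=
  Primrec.list_idxOf.comp (Primrec.const false) Primrec.id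

theorem primrec_pairSnd : Primrec pairSnd :=
  Primrec.nat_sub.comp (Primrec.nat_sub.comp Primrec.list_length primrec_pairFst) (.const 1)

theorem primrec_replicate {α : Type} [Primcodable α] (a : α) :
    Primrec fun n => List.replicate n a := by
  refine (Primrec.list_map Primrec.list_range (Primrec.const a).to₂).of_eq fun n => ?_
  simp

theorem primrec_pairLabel : Primrec₂ pairLabel :=
  Primrec.list_append.comp ((primrec_replicate true).comp Primrec.fst)
    (Primrec.list_cons.comp (Primrec.const false) ((primrec_replicate true).comp Primrec.snd))

/-! ### Deciding the halting paths with the oracle -/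

/-- The local rule of the halting paths at an entry `x`, given its neighbours. -/
def PathRule (V : View (List Bool × List Bool)) (x : ViewEntry (List Bool × List Bool)) : Prop :=
  x.2.1.1 = pairLabel (pairFst x.2.1.1) (pairSnd x.2.1.1) ∧
  pairSnd x.2.1.1 < pairFst x.2.1.1 ∧
  (∀ y ∈ V.nbrs x, pairFst y.2.1.1 = pairFst x.2.1.1 ∧
    (pairSnd y.2.1.1 = pairSnd x.2.1.1 + 1 ∨ pairSnd x.2.1.1 = pairSnd y.2.1.1 + 1)) ∧
  (∀ y ∈ V.nbrs x, ∀ z ∈ V.nbrs x, pairSnd y.2.1.1 = pairSnd z.2.1.1 → y.1 = z.1) ∧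
  (0 < pairSnd x.2.1.1 → ∃ y ∈ V.nbrs x, pairSnd y.2.1.1 + 1 = pairSnd x.2.1.1) ∧
  (pairSnd x.2.1.1 + 1 < pairFst x.2.1.1 →
    ∃ y ∈ V.nbrs x, pairSnd y.2.1.1 = pairSnd x.2.1.1 + 1) ∧
  (x.2.1.2.length = pairFst x.2.1.1 → x.2.1.2[pairFst x.2.1.1 - 1]? = some true)

theorem primrecPred_pathRule : PrimrecPred fun z : View (List Bool × List Bool) ×
    ViewEntry (List Bool × List Bool) => PathRule z.1 z.2 := by
  have lab : Primrec fun x : ViewEntry (List Bool × List Bool) => x.2.1.1 :=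
    Primrec.fst.comp (Primrec.fst.comp Primrec.snd)
  have orc : Primrec fun x : ViewEntry (List Bool × List Bool) => x.2.1.2 :=
    Primrec.snd.comp (Primrec.fst.comp Primrec.snd)
  have f : Primrec fun x : ViewEntry (List Bool × List Bool) => pairFst x.2.1.1 :=
    primrec_pairFst.comp lab
  have s : Primrec fun x : ViewEntry (List Bool × List Bool) => pairSnd x.2.1.1 :=
    primrec_pairSnd.comp lab
  have nb : Primrec fun z : View (List Bool × List Bool) ×
    ViewEntry (List Bool × List Bool) => z.1.nbrs z.2 := View.primrec_nbrs
  unfold PathRule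
  refine .and ?_ (.and ?_ (.and ?_ (.and ?_ (.and ?_ (.and ?_ ?_)))))
  · exact Primrec.eq.comp (lab.comp .snd)
      (primrec_pairLabel.comp (f.comp .snd) (s.comp .snd))
  · exact Primrec.nat_lt.comp (s.comp .snd) (f.comp .snd)
  · refine .forall_mem nb (.and ?_ (.or ?_ ?_))
    · exact Primrec.eq.comp (f.comp .snd) (f.comp (.comp .snd .fst))
    · exact Primrec.eq.comp (s.comp .snd) (Primrec.succ.comp (s.comp (.comp .snd .fst)))
    · exact Primrec.eq.comp (s.comp (.comp .snd .fst)) (Primrec.succ.comp (s.comp .snd))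
  · refine .forall_mem nb (.forall_mem (nb.comp .fst) (.imp ?_ ?_))
    · exact Primrec.eq.comp (s.comp (.comp .snd .fst)) (s.comp .snd)
    · exact Primrec.eq.comp (.comp .fst (.comp .snd .fst)) (.comp .fst .snd)
  · refine .imp (Primrec.nat_lt.comp (.const 0) (s.comp .snd)) (.exists_mem nb ?_)
    exact Primrec.eq.comp (Primrec.succ.comp (s.comp .snd)) (s.comp (.comp .snd .fst))
  · refine .imp (Primrec.nat_lt.comp (Primrec.succ.comp (s.comp .snd)) (f.comp .snd))
      (.exists_mem nb ?_)
    exact Primrec.eq.comp (s.comp .snd) (Primrec.succ.comp (s.comp (.comp .snd .fst)))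
  · refine .imp (Primrec.eq.comp (Primrec.list_length.comp (orc.comp .snd)) (f.comp .snd)) ?_
    exact Primrec.eq.comp (Primrec.list_getElem?.comp (orc.comp .snd)
      (Primrec.pred.comp (f.comp .snd))) (.const _)

open Classical in
/-- The algorithm that checks the path rule. -/
noncomputable def pathAlgorithm : LocalAlgorithm (List Bool × List Bool) where
  radius := 1
  out V := decide (∀ x ∈ V.center, PathRule V x)
  computable := (PrimrecPred.forall_mem View.primrec_center primrecPred_pathRule).computable_decide

/-- The path rule, read in the graph. -/
theorem pathAlgorithm_out (G : LabelledGraph (List Bool × List Bool)) (ids : Fin G.n ↪ ℕ)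
    (v : Fin G.n) : pathAlgorithm.out (G.view ids pathAlgorithm.radius v) = true ↔
  ((G.label v).1 = pairLabel (pairFst (G.label v).1) (pairSnd (G.label v).1) ∧
  pairSnd (G.label v).1 < pairFst (G.label v).1 ∧
  (∀ w, G.graph.Adj v w → pairFst (G.label w).1 = pairFst (G.label v).1 ∧
    (pairSnd (G.label w).1 = pairSnd (G.label v).1 + 1 ∨
      pairSnd (G.label v).1 = pairSnd (G.label w).1 + 1)) ∧
  (∀ w, G.graph.Adj v w → ∀ u, G.graph.Adj v u →
    pairSnd (G.label w).1 = pairSnd (G.label u).1 → w = u) ∧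
  (0 < pairSnd (G.label v).1 →
    ∃ w, G.graph.Adj v w ∧ pairSnd (G.label w).1 + 1 = pairSnd (G.label v).1) ∧
  (pairSnd (G.label v).1 + 1 < pairFst (G.label v).1 →
    ∃ w, G.graph.Adj v w ∧ pairSnd (G.label w).1 = pairSnd (G.label v).1 + 1) ∧
  ((G.label v).2.length = pairFst (G.label v).1 →
    (G.label v).2[pairFst (G.label v).1 - 1]? = some true)) := by
  have h0 : G.graph.dist v v + 1 ≤ 1 := by simp
  simp only [pathAlgorithm, decide_eq_true_eq]
  rw [LabelledGraph.forall_center]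
  simp only [PathRule, G.forall_nbrs ids 1 v h0, G.exists_nbrs ids 1 v h0,
    LabelledGraph.entry_label, LabelledGraph.entry_fst_eq]

theorem pathAlgorithm_identifierOblivious : pathAlgorithm.IdentifierOblivious := by
  intro G ids ids' v
  rw [Bool.eq_iff_iff, pathAlgorithm_out, pathAlgorithm_out]

/-- The second components number the nodes injectively and without gaps. At the largest one the rule
leaves no room for a successor, so the first component there, and hence everywhere, is the number of
nodes. The holder of the last oracle label then checks the right bit. -/
theorem pathAlgorithm_decidesWith : pathAlgorithm.DecidesWith haltingOracle haltingPaths := by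
  intro G π ids
  have hout : pathAlgorithm.Accepts (G.withOracle haltingOracle π) ids ↔
      ∀ v : Fin G.n, _ := forall_congr' fun v => pathAlgorithm_out _ ids v
  rw [hout]
  change _ ↔ ∀ v : Fin G.n,
    (G.label v = pairLabel (pairFst (G.label v)) (pairSnd (G.label v)) ∧
    pairSnd (G.label v) < pairFst (G.label v) ∧
    (∀ w, G.graph.Adj v w → pairFst (G.label w) = pairFst (G.label v) ∧
      (pairSnd (G.label w) = pairSnd (G.label v) + 1 ∨
        pairSnd (G.label v) = pairSnd (G.label w) + 1)) ∧
    (∀ w, G.graph.Adj v w → ∀ u, G.graph.Adj v u →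
      pairSnd (G.label w) = pairSnd (G.label u) → w = u) ∧
    (0 < pairSnd (G.label v) →
      ∃ w, G.graph.Adj v w ∧ pairSnd (G.label w) + 1 = pairSnd (G.label v)) ∧
    (pairSnd (G.label v) + 1 < pairFst (G.label v) →
      ∃ w, G.graph.Adj v w ∧ pairSnd (G.label w) = pairSnd (G.label v) + 1) ∧
    ((haltingOracle.label G.n (π v)).length = pairFst (G.label v) →
      (haltingOracle.label G.n (π v))[pairFst (G.label v) - 1]? = some true))
  constructor
  · rintro ⟨i, hn, hhalt, e, he⟩ v
    have hadj : ∀ w, G.graph.Adj v w ↔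
        (e v : ℕ) + 1 = e w ∨ (e w : ℕ) + 1 = e v := fun w => by
      rw [← e.map_adj_iff, SimpleGraph.pathGraph_adj]
    simp only [he, pairFst_pairLabel, pairSnd_pairLabel, hadj, true_and]
    refine ⟨(e v).isLt, ?_, ?_, ?_, ?_, ?_⟩
    · intro w hw; omega
    · intro w _ u _ h
      exact e.injective (Fin.ext h)
    · intro h
      refine ⟨e.symm ⟨e v - 1, by omega⟩, ?_⟩
      simp; omega
    · intro h
      refine ⟨e.symm ⟨e v + 1, h⟩, ?_⟩
      simp
    · intro h
      -- The label `[false]` has length `1`, so it passes the length test only for `n = 1`, where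
      -- the only label is the last one.
      have hπ : (π v : ℕ) + 1 = G.n := by
        by_contra hne
        rw [haltingOracle_label_of_lt hne] at h
        simp at h
        have := (π v).isLt
        omega
      rw [haltingOracle_label_of_eq hπ, hn]
      exact (haltingBits_getElem? i).2 hhalt
  · intro h
    have hne : Nonempty (Fin G.n) := G.connected.nonempty
    have hinj : Function.Injective fun v => pairSnd (G.label v) := by
      refine injective_of_locally_path (R := G.graph.Adj) G.connected.reflTransGen
        (fun _ _ h => h.symm) (fun x y hxy => ((h x).2.2.1 y hxy).2)
        (fun x y z hy hz => (h x).2.2.2.1 y hy z hz) (fun x hx => (h x).2.2.2.2.1 hx)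
    obtain ⟨x, hmax, hcard⟩ := exists_card_eq_of_injective hinj fun x hx => by
      obtain ⟨y, _, hy⟩ := (h x).2.2.2.2.1 hx
      exact ⟨y, hy⟩
    rw [Fintype.card_fin] at hcard
    have hfst : ∀ v, pairFst (G.label v) = G.n := by
      have hx : pairFst (G.label x) = G.n := by
        have h1 := (h x).2.1
        have h2 := (h x).2.2.2.2.2.1
        by_contra hne
        obtain ⟨w, _, hw⟩ := h2 (by omega)
        have := hmax w
        omega
      intro v
      induction G.connected.reflTransGen x v with
      | refl => exact hx
      | tail _ hyz ih => rw [((h _).2.2.1 _ hyz).1, ih]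
    obtain ⟨i, hi⟩ : ∃ i, G.n = i + 1 := ⟨_, hcard⟩
    have hlt : ∀ v, pairSnd (G.label v) < G.n := fun v => by
      have := (h v).2.1
      rwa [hfst v] at this
    refine ⟨i, hi, ?_, ?_⟩
    · obtain ⟨v, hv⟩ := exists_perm_eq_last G.n_pos π
      have := (h v).2.2.2.2.2.2
      rw [haltingOracle_label_of_eq hv, length_haltingBits, hfst v, hi] at this
      exact (haltingBits_getElem? i).1 (this rfl)
    · let g : Fin G.n → Fin G.n := fun v => ⟨pairSnd (G.label v), hlt v⟩
      have hg : Function.Injective g := fun a b hab => hinj (congrArg Fin.val hab)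
      let e : Fin G.n ≃ Fin G.n := Equiv.ofBijective g (Finite.injective_iff_bijective.1 hg)
      refine ⟨⟨e, ?_⟩, fun v => ?_⟩
      · intro a b
        rw [SimpleGraph.pathGraph_adj]
        change pairSnd (G.label a) + 1 = pairSnd (G.label b) ∨
          pairSnd (G.label b) + 1 = pairSnd (G.label a) ↔ _
        constructor
        · rintro (hab | hab)
          · obtain ⟨w, hw, hw'⟩ := (h a).2.2.2.2.2.1 (by
              rw [hfst a, hab]; exact hlt b)
            have : w = b := hinj (by simp only; omega)
            rwa [← this]
          · obtain ⟨w, hw, hw'⟩ := (h a).2.2.2.2.1 (by omega)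
            have : w = b := hinj (by simp only; omega)
            rwa [← this]
        · intro hab
          have := ((h a).2.2.1 b hab).2
          omega
      · have := (h v).1
        rw [hfst v] at this
        exact this

theorem haltingPaths_mem_LDOWith : haltingPaths ∈ LDOWith haltingOracle :=
  ⟨pathAlgorithm, pathAlgorithm_identifierOblivious, pathAlgorithm_decidesWith⟩

/-! ### Finite Turing machines as tables -/

section Lookup

variable {κ β : Type} [BEq κ] [LawfulBEq κ]

theorem List.lookup_eq_some_of_mem {l : List (κ × β)} {k : κ} {v : β} (h : (k, v) ∈ l)
    (hu : ∀ v', (k, v') ∈ l → v' = v) : l.lookup k = some v := by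
  induction l with
  | nil => simp at h
  | cons x l ih =>
    obtain ⟨k', v'⟩ := x
    by_cases hk : k = k'
    · subst hk
      simp [hu v' (by simp)]
    · rw [List.lookup_cons, beq_false_of_ne hk]
      refine ih ?_ fun v'' hv'' => hu v'' (List.mem_cons_of_mem _ hv'')
      simpa [hk] using h

theorem List.lookup_eq_none_of_notMem {l : List (κ × β)} {k : κ} (h : ∀ v, (k, v) ∉ l) :
    l.lookup k = none := by
  rw [List.lookup_eq_none_iff]
  rintro ⟨k', v⟩ hp
  by_contra hne
  have : k = k' := by simpa using hne
  exact h v (this ▸ hp)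

end Lookup

open Turing StateTransition

/-- The number of an action, the inverse of `tmAction`. -/
def actionNumber {Γ : Type} (g : Γ → ℕ) : TM0.Stmt Γ → ℕ
  | TM0.Stmt.move Dir.left => 0
  | TM0.Stmt.move Dir.right => 1
  | TM0.Stmt.write a => g a + 2

/-- A machine with finitely many states and symbols is simulated by a table whose states are odd,
also in the presence of entries for even states. -/
theorem exists_table_simulating {Γ Λ : Type} [Inhabited Γ] [Inhabited Λ] [Finite Γ]
    (M : TM0.Machine Γ Λ) (S : Finset Λ) (hS : TM0.Supports M (S : Set Λ)) :
    ∃ (T₀ : TMTable) (g : PointedMap Γ ℕ) (q₀ : ℕ), ∀ P : TMTable, (∀ x ∈ P, Even x.1.1) →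
      ∀ tape : Tape Γ,
        (eval (TM0.step (TMTable.machine (P ++ T₀))) ⟨q₀, tape.map g⟩).Dom ↔
          (eval (TM0.step M) ⟨default, tape⟩).Dom := by
  classical
  have := Fintype.ofFinite Γ
  have : Encodable Γ := Encodable.ofCountable Γ
  have : Encodable S := Encodable.ofCountable S
  -- The blank has to go to the blank `0`; all other symbols go to positive numbers.
  let g : PointedMap Γ ℕ :=
    ⟨fun a => if a = default then 0 else Encodable.encode a + 1, by simp⟩
  have hg : ∀ a b, g a = g b → a = b := by
    intro a b hab
    change (if a = default then 0 else Encodable.encode a + 1)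
      = (if b = default then 0 else Encodable.encode b + 1) at hab
    split_ifs at hab with h1 h2 h2
    · rw [h1, h2]
    · exact Encodable.encode_injective (by omega)
  -- States in `S` get distinct odd numbers. The value outside `S` is arbitrary but odd; these
  -- states are never entered.
  let gs : Λ → ℕ := fun q => if h : q ∈ S then 2 * Encodable.encode (⟨q, h⟩ : S) + 1 else 1
  have hgs : ∀ q ∈ S, ∀ q' ∈ S, gs q = gs q' → q = q' := by
    intro q hq q' hq' h
    simp only [gs, dif_pos hq, dif_pos hq'] at h
    have : (⟨q, hq⟩ : S) = ⟨q', hq'⟩ := Encodable.encode_injective (by omega)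
    exact congrArg Subtype.val this
  have hodd : ∀ q, ¬ Even (gs q) := by
    intro q
    simp only [gs]
    split_ifs <;> simp [Nat.even_add_one]
  let T₀ : TMTable := (S.toList ×ˢ (Finset.univ : Finset Γ).toList).filterMap fun z =>
    (M z.1 z.2).map fun p => ((gs z.1, g z.2), (gs p.1, actionNumber g p.2))
  have hmem : ∀ q ∈ S, ∀ a v, ((gs q, g a), v) ∈ T₀ ↔
      ∃ p, M q a = some p ∧ (gs p.1, actionNumber g p.2) = v := by
    intro q hq a v
    simp only [T₀, List.mem_filterMap, Option.map_eq_some_iff, Prod.exists, List.mem_product,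
      Finset.mem_toList, Finset.mem_univ, and_true, Prod.mk.injEq]
    constructor
    · rintro ⟨q', a', hq', p, s, hM, ⟨h1, h2⟩, h3⟩
      obtain rfl := hgs _ hq' _ hq h1
      obtain rfl := hg _ _ h2
      exact ⟨p, s, hM, h3⟩
    · rintro ⟨p, s, hM, h3⟩
      exact ⟨q, a, hq, p, s, hM, ⟨rfl, rfl⟩, h3⟩
  have hact : ∀ s : TM0.Stmt Γ, tmAction (actionNumber g s) = s.map g := by
    rintro ((_ | _) | _) <;> rfl
  have hmachine : ∀ P : TMTable, (∀ x ∈ P, Even x.1.1) → ∀ q ∈ S, ∀ a,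
      TMTable.machine (P ++ T₀) (gs q) (g a) = (M q a).map (Prod.map gs (TM0.Stmt.map g)) := by
    intro P hP q hq a
    -- The keys of `P` have even states, so a lookup at an odd state falls through to `T₀`.
    have h1 : P.lookup (gs q, g a) = none :=
      List.lookup_eq_none_of_notMem fun v hv => hodd q (hP _ hv)
    have h2 : T₀.lookup (gs q, g a) = (M q a).map fun p => (gs p.1, actionNumber g p.2) := by
      rcases hM : M q a with _ | p
      · refine List.lookup_eq_none_of_notMem fun v hv => ?_
        obtain ⟨p, hp, _⟩ := (hmem q hq a v).1 hv
        rw [hM] at hp; cases hp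
      · refine List.lookup_eq_some_of_mem ((hmem q hq a _).2 ⟨p, hM, rfl⟩) fun v' hv' => ?_
        obtain ⟨p', hp', h⟩ := (hmem q hq a v').1 hv'
        rw [hM] at hp'
        cases hp'
        exact h.symm
    unfold TMTable.machine
    rw [List.lookup_append, h1, h2, Option.none_or, Option.map_map]
    congr 1
    funext p
    simp [hact, Prod.map]
  refine ⟨T₀, g, gs default, fun P hP tape => ?_⟩
  have hresp : Respects (TM0.step M) (TM0.step (TMTable.machine (P ++ T₀)))
      fun a b => a.q ∈ S ∧ TM0.Cfg.map g gs a = b := by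
    have hstep : ∀ c : TM0.Cfg Γ Λ, c.q ∈ S →
        (TM0.step M c).map (TM0.Cfg.map g gs)
          = TM0.step (TMTable.machine (P ++ T₀)) (TM0.Cfg.map g gs c) := by
      rintro ⟨q, T⟩ hq
      unfold TM0.step TM0.Cfg.map
      simp only [Tape.map_fst, hmachine P hP q hq]
      rcases M q T.1 with _ | ⟨q', d | a⟩
      · rfl
      · simp only [Option.map_some, Tape.map_move g]
        rfl
      · simp only [Option.map_some, Tape.map_write]
        rfl
    rintro c _ ⟨cs, rfl⟩
    cases e : TM0.step M c
    · change TM0.step _ _ = none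
      rw [← hstep c cs, e]; rfl
    · refine ⟨_, ⟨TM0.step_supports M hS e cs, rfl⟩, Relation.TransGen.single ?_⟩
      rw [← hstep c cs, e]; rfl
  exact tr_eval_dom hresp (a₁ := ⟨default, tape⟩) ⟨hS.1, rfl⟩

/-! ### Machines for partial recursive functions -/

/-- Digits come least significant first. Powers of two are used as inputs because their encodings
are repetitive enough to be written by a simple table. -/
theorem trNat_two_pow (m : ℕ) : PartrecToTM2.trNat (2 ^ m)
    = List.replicate m PartrecToTM2.Γ'.bit0 ++ [PartrecToTM2.Γ'.bit1] := by
  have h : ∀ m : ℕ, ∃ p : PosNum, ((2 ^ m : ℕ) : Num) = Num.pos p ∧ PartrecToTM2.trPosNum p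
      = List.replicate m PartrecToTM2.Γ'.bit0 ++ [PartrecToTM2.Γ'.bit1] := by
    intro m
    induction m with
    | zero => exact ⟨PosNum.one, by simp; rfl, rfl⟩
    | succ m ih =>
      obtain ⟨p, hp, ht⟩ := ih
      refine ⟨p.bit0, ?_, ?_⟩
      · rw [pow_succ, mul_two, Nat.cast_add, hp, Num.bit0_of_bit0]
        rfl
      · rw [PartrecToTM2.trPosNum, ht]
        rfl
  obtain ⟨p, hp, ht⟩ := h m
  rw [PartrecToTM2.trNat, hp, ← ht]
  rfl

/-- Feeding `2 ^ m` instead of `m` costs nothing: `m` is recovered by a bounded search before `f` is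
applied. -/
theorem exists_partrec_two_pow {f : ℕ →. ℕ} (hf : Partrec f) :
    ∃ f' : ℕ →. ℕ, Partrec f' ∧ ∀ m, f' (2 ^ m) = f m := by
  have hp : Primrec fun x : ℕ => 2 ^ x := by
    refine (Primrec.nat_rec₁ 1 (Primrec.nat_mul.comp .snd (.const 2)).to₂).of_eq fun n => ?_
    induction n with
    | zero => rfl
    | succ n ih => rw [pow_succ, ← ih]
  have hl : Primrec fun x : ℕ => (List.range x).findIdx fun m => decide (2 ^ m = x) :=
    Primrec.list_findIdx Primrec.list_range
      (Primrec.eq.comp (hp.comp Primrec.snd) Primrec.fst).decide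
  refine ⟨fun x => f _, hf.comp hl.to_comp, fun m => ?_⟩
  have hm : m < (List.range (2 ^ m)).length := by simpa using Nat.lt_two_pow_self
  have : (List.range (2 ^ m)).findIdx (fun k => decide (2 ^ k = 2 ^ m)) = m := by
    rw [List.findIdx_eq hm]
    simp
    intro j hj
    omega
  change f _ = f m
  rw [this]

/-- A finite machine that, on an encoding of `m`, halts if and only if `f m` is defined. -/
theorem exists_machine_of_partrec {f : ℕ →. ℕ} (hf : Partrec f) :
    ∃ (Γ Λ : Type) (_ : Inhabited Γ) (_ : Inhabited Λ) (_ : Finite Γ) (M : TM0.Machine Γ Λ)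
      (S : Finset Λ) (a b c : Γ), TM0.Supports M (S : Set Λ) ∧
      ∀ m, (eval (TM0.step M) ⟨default, Tape.mk₁ (a :: b :: List.replicate m c)⟩).Dom ↔
        (f m).Dom := by
  obtain ⟨f', hf', hff⟩ := exists_partrec_two_pow hf
  obtain ⟨c, hc⟩ := ToPartrec.Code.exists_code (Nat.Partrec'.part_iff₁.2 hf')
  -- The default state is the initial one, so this instance makes the machine start with the code
  -- `c`.
  let i1 : Inhabited PartrecToTM2.Λ' :=
    ⟨PartrecToTM2.trNormal c PartrecToTM2.Cont'.halt⟩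
  have h2 : ∀ v, (TM2.eval (Γ := fun _ : PartrecToTM2.K' => PartrecToTM2.Γ') PartrecToTM2.tr
      PartrecToTM2.K'.main (PartrecToTM2.trList v)).Dom ↔ (c.eval v).Dom := by
    intro v
    have hinit : TM2.init (Γ := fun _ : PartrecToTM2.K' => PartrecToTM2.Γ')
        (Λ := PartrecToTM2.Λ') (σ := Option PartrecToTM2.Γ')
        PartrecToTM2.K'.main (PartrecToTM2.trList v) = PartrecToTM2.init c v := by
      unfold TM2.init PartrecToTM2.init
      congr 1
      funext k
      cases k <;> simp [PartrecToTM2.K'.elim]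
    unfold TM2.eval
    rw [hinit]
    have := PartrecToTM2.tr_eval c v
    erw [this]
    rfl
  let M₁ := TM2to1.tr (K := PartrecToTM2.K') (Γ := fun _ => PartrecToTM2.Γ') PartrecToTM2.tr
  let M₀ := TM1to0.tr M₁
  let S₂ := PartrecToTM2.codeSupp c PartrecToTM2.Cont'.halt
  have hs₂ : TM2.Supports PartrecToTM2.tr S₂ := PartrecToTM2.tr_supports c _
  have hs₁ := TM2to1.tr_supports _ hs₂
  have hs₀ := TM1to0.tr_supports M₁ hs₁
  have h0 : ∀ v, (TM0.eval M₀ (TM2to1.trInit PartrecToTM2.K'.main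
      (PartrecToTM2.trList v))).Dom ↔ (c.eval v).Dom := by
    intro v
    have e : TM0.eval M₀ (TM2to1.trInit PartrecToTM2.K'.main (PartrecToTM2.trList v)) = _ :=
      TM1to0.tr_eval M₁ _
    rw [e]
    exact (TM2to1.tr_eval_dom PartrecToTM2.tr PartrecToTM2.K'.main
      (PartrecToTM2.trList v)).trans (h2 v)
  refine ⟨_, _, inferInstance, inferInstance, ?_, M₀, _,
    (true, Function.update (fun _ => none) PartrecToTM2.K'.main (some PartrecToTM2.Γ'.cons)),
    (false, Function.update (fun _ => none) PartrecToTM2.K'.main (some PartrecToTM2.Γ'.bit1)),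
    (false, Function.update (fun _ => none) PartrecToTM2.K'.main (some PartrecToTM2.Γ'.bit0)),
    hs₀, fun m => ?_⟩
  · have : Finite PartrecToTM2.K' := by
      refine Finite.of_surjective (![PartrecToTM2.K'.main, PartrecToTM2.K'.rev,
        PartrecToTM2.K'.aux, PartrecToTM2.K'.stack]) ?_
      rintro (_ | _ | _ | _)
      exacts [⟨0, rfl⟩, ⟨1, rfl⟩, ⟨2, rfl⟩, ⟨3, rfl⟩]
    change Finite (Bool × ∀ _ : PartrecToTM2.K', Option PartrecToTM2.Γ')
    infer_instance
  · have h := h0 [2 ^ m]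
    have he := hc ⟨[2 ^ m], rfl⟩
    -- The stack is laid on the tape from the bottom up, hence the reversal. In the tape symbols the
    -- Boolean marks the bottom cell, and only the main stack is occupied.
    have hrev : (PartrecToTM2.trList [2 ^ m]).reverse = PartrecToTM2.Γ'.cons ::
        PartrecToTM2.Γ'.bit1 :: List.replicate m PartrecToTM2.Γ'.bit0 := by
      simp [trNat_two_pow]
    have hin : TM2to1.trInit (K := PartrecToTM2.K') (Γ := fun _ => PartrecToTM2.Γ')
      PartrecToTM2.K'.main (PartrecToTM2.trList [2 ^ m]) =
      (true, Function.update (fun _ => none) PartrecToTM2.K'.main (some PartrecToTM2.Γ'.cons)) ::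
      (false, Function.update (fun _ => none) PartrecToTM2.K'.main (some PartrecToTM2.Γ'.bit1)) ::
      List.replicate m
      (false, Function.update (fun _ => none) PartrecToTM2.K'.main
        (some PartrecToTM2.Γ'.bit0)) := by
      unfold TM2to1.trInit
      rw [hrev]
      exact congrArg (List.cons _) (congrArg (List.cons _) List.map_replicate)
    rw [hin] at h
    refine Iff.trans ?_ (h.trans ?_)
    · rfl
    · change (c.eval [2 ^ m]) = pure <$> f' (2 ^ m) at he
      rw [he, hff]
      rfl

/-! ### Writing an input on the empty tape -/

/-- Entries that write `a, b, c, …, c` (with `m` copies of `c`) on the empty tape, from right to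
left, and then go to the state `q`. -/
def writeTable (a b c q m : ℕ) : TMTable :=
  (List.range m).map (fun j => ((4 * j, 0), (4 * j + 2, c + 2))) ++
  ((List.range m).map (fun j => ((4 * j + 2, c), (4 * j + 4, 0))) ++
  [((4 * m, 0), (4 * m + 2, b + 2)), ((4 * m + 2, b), (4 * m + 4, 0)), ((4 * m + 4, 0), (q, a + 2))])

theorem mem_writeTable {a b c q m : ℕ} {k v : ℕ × ℕ} : (k, v) ∈ writeTable a b c q m ↔
    (∃ j < m, k = (4 * j, 0) ∧ v = (4 * j + 2, c + 2)) ∨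
    (∃ j < m, k = (4 * j + 2, c) ∧ v = (4 * j + 4, 0)) ∨
    (k = (4 * m, 0) ∧ v = (4 * m + 2, b + 2)) ∨ (k = (4 * m + 2, b) ∧ v = (4 * m + 4, 0)) ∨
    (k = (4 * m + 4, 0) ∧ v = (q, a + 2)) := by
  simp only [writeTable, List.mem_append, List.mem_map, List.mem_range, List.mem_cons,
    List.not_mem_nil, or_false, Prod.mk.injEq]
  simp only [eq_comm (b := k), eq_comm (b := v)]

theorem even_of_mem_writeTable {a b c q m : ℕ} : ∀ x ∈ writeTable a b c q m, Even x.1.1 := by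
  rintro ⟨k, v⟩ h
  rcases mem_writeTable.1 h with ⟨j, _, rfl, _⟩ | ⟨j, _, rfl, _⟩ | ⟨rfl, _⟩ | ⟨rfl, _⟩ | ⟨rfl, _⟩ <;>
    simp only [Nat.even_iff] <;> omega

theorem writeTable_unique {a b c q m : ℕ} {k v v' : ℕ × ℕ} (h : (k, v) ∈ writeTable a b c q m)
    (h' : (k, v') ∈ writeTable a b c q m) : v' = v := by
  rw [mem_writeTable] at h h'
  rcases h with ⟨j, hj, rfl, rfl⟩ | ⟨j, hj, rfl, rfl⟩ | ⟨rfl, rfl⟩ | ⟨rfl, rfl⟩ | ⟨rfl, rfl⟩ <;>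
  rcases h' with ⟨i, hi, h1, rfl⟩ | ⟨i, hi, h1, rfl⟩ | ⟨h1, rfl⟩ | ⟨h1, rfl⟩ | ⟨h1, rfl⟩ <;>
  simp only [Prod.mk.injEq, and_true] at h1 ⊢ <;> omega

theorem primrec_writeTable (a b c q : ℕ) : Primrec (writeTable a b c q) := by
  have m4 : ∀ k, Primrec fun j : ℕ => 4 * j + k := fun k =>
    Primrec.nat_add.comp (Primrec.nat_mul.comp (.const 4) .id) (.const k)
  refine Primrec.list_append.comp (Primrec.list_map .list_range ?_)
    (Primrec.list_append.comp (Primrec.list_map .list_range ?_)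
    (Primrec.list_cons.comp ?_ (Primrec.list_cons.comp ?_ (Primrec.list_cons.comp ?_
      (.const [])))))
  · exact (Primrec.pair (.pair (m4 0) (.const _)) (.pair (m4 2) (.const _))).comp .snd
  · exact (Primrec.pair (.pair (m4 2) (.const _)) (.pair (m4 4) (.const _))).comp .snd
  · exact .pair (.pair (m4 0) (.const _)) (.pair (m4 2) (.const _))
  · exact .pair (.pair (m4 2) (.const _)) (.pair (m4 4) (.const _))
  · exact .pair (.pair (m4 4) (.const _)) (.pair (.const _) (.const _))

theorem reaches_of_writeTable (a b c q m : ℕ) (T : TMTable) :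
    Reaches (TM0.step (TMTable.machine (writeTable a b c q m ++ T))) (TM0.init [])
      ⟨q, Tape.mk₁ (a :: b :: List.replicate m c)⟩ := by
  set M := TMTable.machine (writeTable a b c q m ++ T) with hM
  -- Throughout the writing phase the tape is blank to the left of the head.
  let tp : ℕ → List ℕ → Tape ℕ := fun x l => Tape.mk' (ListBlank.mk []) (ListBlank.mk (x :: l))
  have hl : ∀ {k v : ℕ × ℕ}, (k, v) ∈ writeTable a b c q m →
      M k.1 k.2 = some (v.1, tmAction v.2) := by
    intro k v h
    have : (writeTable a b c q m).lookup k = some v :=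
      List.lookup_eq_some_of_mem h fun v' h' => writeTable_unique h h'
    rw [hM]
    unfold TMTable.machine
    rw [List.lookup_append, this]
    rfl
  have hw : ∀ {s x s' y : ℕ} {l : List ℕ}, M s x = some (s', tmAction (y + 2)) →
      TM0.step M ⟨s, tp x l⟩ = some ⟨s', tp y l⟩ := by
    intro s x s' y l h
    have hx : (tp x l).head = x := by simp [tp]
    unfold TM0.step
    simp only [hx, h, Option.map_some, tmAction]
    congr 2
  have hm : ∀ {s x s' : ℕ} {l : List ℕ}, M s x = some (s', tmAction 0) →
      TM0.step M ⟨s, tp x l⟩ = some ⟨s', tp 0 (x :: l)⟩ := by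
    intro s x s' l h
    have hx : (tp x l).head = x := by simp [tp]
    unfold TM0.step
    simp only [hx, h, Option.map_some, tmAction]
    congr 2
  have hreach : ∀ j ≤ m, Reaches (TM0.step M) (TM0.init [])
      ⟨4 * j, tp 0 (List.replicate j c)⟩ := by
    intro j
    induction j with
    | zero =>
      intro _
      have : tp 0 [] = Tape.mk₁ [] := by
        simp only [tp, Tape.mk₁, Tape.mk₂]
        congr 1
        exact ListBlank.cons_head_tail (ListBlank.mk ([] : List ℕ))
      rw [List.replicate_zero, this]
      exact .refl
    | succ j ih =>
      intro hj
      refine ((ih (by omega)).tail (hw (hl (k := (4 * j, 0)) (v := (4 * j + 2, c + 2)) ?_))).tail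
        (hm (hl (k := (4 * j + 2, c)) (v := (4 * j + 4, 0)) ?_))
      · exact mem_writeTable.2 (.inl ⟨j, by omega, rfl, rfl⟩)
      · exact mem_writeTable.2 (.inr (.inl ⟨j, by omega, rfl, rfl⟩))
  refine (((hreach m le_rfl).tail (hw (hl (k := (4 * m, 0)) (v := (4 * m + 2, b + 2)) ?_))).tail
        (hm (hl (k := (4 * m + 2, b)) (v := (4 * m + 4, 0)) ?_))).tail
        (hw (hl (k := (4 * m + 4, 0)) (v := (q, a + 2)) ?_))
  · exact mem_writeTable.2 (by simp)
  · exact mem_writeTable.2 (by simp)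
  · exact mem_writeTable.2 (by simp)

/-! ### Halting on the empty tape is undecidable -/

/-- Halting of program `m` on input `0` reduces to halting of a table on the empty tape. The table
depends primitive recursively on `m`, since only its writing part varies. -/
theorem not_computable_halts :
    ¬ ∃ g : ℕ → Bool, Computable g ∧ ∀ i, g i = true ↔ (turingMachine i).Halts := by
  rintro ⟨g, hg, hgi⟩
  let f : ℕ →. ℕ := fun m => (Denumerable.ofNat Nat.Partrec.Code m).eval 0
  have hf : Partrec f := Nat.Partrec.Code.eval_part.comp (Computable.ofNat _) (.const 0)
  obtain ⟨Γ, Λ, _, _, _, M, S, a, b, c, hS, hM⟩ := exists_machine_of_partrec hf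
  obtain ⟨T₀, e, q, hT⟩ := exists_table_simulating M S hS
  let T : ℕ → TMTable := fun m => writeTable (e a) (e b) (e c) q m ++ T₀
  have hTc : Primrec T := Primrec.list_append.comp (primrec_writeTable ..) (.const T₀)
  have hhalt : ∀ m, (T m).Halts ↔ (f m).Dom := by
    intro m
    have h1 := hT (writeTable (e a) (e b) (e c) q m) even_of_mem_writeTable
      (Tape.mk₁ (a :: b :: List.replicate m c))
    rw [hM, Tape.map_mk₁] at h1
    rw [← h1]
    -- The run is deterministic, so evaluation may start after the writing phase.
    have h2 := reaches_eval (reaches_of_writeTable (e a) (e b) (e c) q m T₀)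
    unfold TMTable.Halts TM0.eval
    change (eval _ _).Dom ↔ _
    rw [h2]
    simp
  refine ComputablePred.halting_problem 0 ?_
  refine ComputablePred.of_eq (p := fun c : Nat.Partrec.Code =>
    g (Encodable.encode (T (Encodable.encode c))) = true) ?_ fun c => ?_
  · refine ⟨inferInstance, ?_⟩
    refine (hg.comp (Computable.encode.comp (hTc.to_comp.comp Computable.encode))).of_eq fun c => ?_
    simp
  · rw [hgi, turingMachine, Denumerable.ofNat_encode, hhalt]
    simp [f]

/-! ### The views of the labelled paths -/

theorem SimpleGraph.pathGraph_dist_le_iff {n : ℕ} (hc : (SimpleGraph.pathGraph n).Connected)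
    {r : ℕ} {v u : Fin n} : (SimpleGraph.pathGraph n).dist v u ≤ r ↔
      (u : ℕ) ≤ v + r ∧ (v : ℕ) ≤ u + r := by
  constructor
  · intro h
    obtain ⟨p, hp⟩ := hc.exists_walk_length_eq_dist v u
    have : ∀ {a b : Fin n} (p : (SimpleGraph.pathGraph n).Walk a b),
        (b : ℕ) ≤ a + p.length ∧ (a : ℕ) ≤ b + p.length := by
      intro a b p
      induction p with
      | nil => simp
      | cons h p ih =>
        rw [SimpleGraph.pathGraph_adj] at h
        simp only [SimpleGraph.Walk.length_cons]
        omega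
    have := this p
    omega
  · have key : ∀ (k : ℕ) (a b : Fin n), (a : ℕ) + k = b →
        (SimpleGraph.pathGraph n).dist a b ≤ k := by
      intro k
      induction k with
      | zero =>
        intro a b h
        obtain rfl : a = b := Fin.ext (by omega)
        simp
      | succ k ih =>
        intro a b h
        have h1 := ih a ⟨a + k, by omega⟩ rfl
        have h2 : (SimpleGraph.pathGraph n).dist ⟨a + k, by omega⟩ b = 1 :=
          SimpleGraph.dist_eq_one_iff_adj.2 (SimpleGraph.pathGraph_adj.2 (.inl (by simp; omega)))
        have := hc.dist_triangle (u := a) (v := ⟨a + k, by omega⟩) (w := b)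
        omega
    rintro ⟨h1, h2⟩
    rcases le_total (v : ℕ) u with h | h
    · have := key (u - v) v u (by omega)
      omega
    · have := key (v - u) u v (by omega)
      rw [SimpleGraph.dist_comm]
      omega

/-- The labelled path with `i + 1` nodes. -/
def labelledPath (i : ℕ) : LabelledGraph (List Bool) where
  n := i + 1
  graph := SimpleGraph.pathGraph (i + 1)
  connected := SimpleGraph.pathGraph_connected i
  label v := pairLabel (i + 1) v

theorem labelledPath_mem_iff (i : ℕ) :
    labelledPath i ∈ haltingPaths ↔ (turingMachine i).Halts := by
  constructor
  · rintro ⟨j, hj, h, _⟩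
    have : i + 1 = j + 1 := hj
    obtain rfl : i = j := by omega
    exact h
  · intro h
    exact ⟨i, rfl, h, SimpleGraph.Iso.refl, fun _ => rfl⟩

/-- The numbers of the nodes at distance at most `r` from `v` in a path with `n` nodes. -/
def pathBall (r n v : ℕ) : List ℕ := (List.range n).filter fun u => u ≤ v + r ∧ v ≤ u + r

/-- The view of the node `v` in the labelled path with `n` nodes. -/
def pathView (r n v : ℕ) : View (List Bool) :=
  (v, (pathBall r n v).map fun u =>
    (u, pairLabel n u, (pathBall r n v).filter fun w => u + 1 = w ∨ w + 1 = u))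

/-- When the identifiers are the positions, the sorted ball is an interval of numbers, which makes
the view an explicit primitive recursive function. -/
theorem labelledPath_view (r i : ℕ) (v : Fin (i + 1)) :
    (labelledPath i).view Fin.valEmbedding r v = pathView r (i + 1) v := by
  classical
  have hball : ((labelledPath i).ball Fin.valEmbedding r v).map Fin.val
      = pathBall r (i + 1) v := by
    have hsort : (pathBall r (i + 1) v).Pairwise (· ≤ ·) :=
      (List.pairwise_le_range).filter _
    refine List.Perm.eq_of_pairwise (le := (· ≤ ·)) (fun a b _ _ h1 h2 => le_antisymm h1 h2)
      ?_ hsort ?_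
    · rw [List.pairwise_map]
      exact LabelledGraph.pairwise_ball (labelledPath i) Fin.valEmbedding r v
    · refine (List.perm_ext_iff_of_nodup ?_ ?_).2 fun u => ?_
      · exact (LabelledGraph.nodup_ball ..).map Fin.val_injective
      · exact List.nodup_range.filter _
      · have hmem : ∀ w : Fin (i + 1), w ∈ (labelledPath i).ball Fin.valEmbedding r v ↔
            (w : ℕ) ≤ v + r ∧ (v : ℕ) ≤ w + r := fun w =>
          (LabelledGraph.mem_ball (labelledPath i) Fin.valEmbedding r v w).trans
            (SimpleGraph.pathGraph_dist_le_iff (SimpleGraph.pathGraph_connected i))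
        simp only [List.mem_map, pathBall, List.mem_filter, List.mem_range, decide_eq_true_eq]
        constructor
        · rintro ⟨w, hw, rfl⟩
          exact ⟨w.isLt, (hmem w).1 hw⟩
        · rintro ⟨hu, h⟩
          exact ⟨⟨u, hu⟩, (hmem _).2 h, rfl⟩
  unfold LabelledGraph.view pathView
  refine Prod.ext rfl ?_
  rw [← hball]
  change List.map _ _ = List.map _ _
  rw [List.map_map]
  refine List.map_congr_left fun u _ => Prod.ext rfl (Prod.ext rfl ?_)
  rw [Function.comp, List.filter_map]
  change List.map Fin.val _ = List.map Fin.val _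
  congr 1
  refine List.filter_congr fun w _ => ?_
  simp only [Function.comp, decide_eq_decide]
  exact SimpleGraph.pathGraph_adj

theorem primrec_pathBall (r : ℕ) : Primrec₂ (pathBall r) := by
  unfold pathBall
  refine PrimrecPred.primrec_filter
    (P := fun (z : ℕ × ℕ) (u : ℕ) => u ≤ z.2 + r ∧ z.2 ≤ u + r)
    (Primrec.list_range.comp .fst) (.and ?_ ?_)
  · exact Primrec.nat_le.comp .snd (Primrec.nat_add.comp (.comp .snd .fst) (.const r))
  · exact Primrec.nat_le.comp (.comp .snd .fst) (Primrec.nat_add.comp .snd (.const r))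

theorem primrec_pathView (r : ℕ) : Primrec₂ (pathView r) := by
  have hb : Primrec fun z : ℕ × ℕ => pathBall r z.1 z.2 := primrec_pathBall r
  refine Primrec.pair .snd (Primrec.list_map hb (Primrec.pair .snd (Primrec.pair ?_ ?_)))
  · exact primrec_pairLabel.comp (.comp .fst .fst) .snd
  · refine PrimrecPred.primrec_filter
      (P := fun (z : (ℕ × ℕ) × ℕ) (w : ℕ) => z.2 + 1 = w ∨ w + 1 = z.2) (hb.comp .fst) (.or ?_ ?_)
    · exact Primrec.eq.comp (Primrec.succ.comp (.comp .snd .fst)) .snd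
    · exact Primrec.eq.comp (Primrec.succ.comp .snd) (.comp .snd .fst)

theorem computable_forall_lt {p : ℕ → ℕ → Bool} (hp : Computable₂ p) :
    ∃ g : ℕ → Bool, Computable g ∧ ∀ n, g n = true ↔ ∀ k < n, p n k = true := by
  refine ⟨fun n => Nat.rec (motive := fun _ => Bool) true (fun k acc => acc && p n k) n, ?_, ?_⟩
  · refine Computable.nat_rec (h := fun n z => z.2 && p n z.1) .id (.const true) ?_
    exact Primrec.and.to_comp.comp (.comp .snd .snd) (hp.comp .fst (.comp .fst .snd))
  · intro n
    have : ∀ m, (Nat.rec (motive := fun _ => Bool) true (fun k acc => acc && p n k) m) = true ↔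
        ∀ k < m, p n k = true := by
      intro m
      induction m with
      | zero => simp
      | succ m ih =>
        simp only [Bool.and_eq_true, ih, Nat.lt_succ_iff_lt_or_eq]
        constructor
        · rintro ⟨h1, h2⟩ k (hk | rfl)
          exacts [h1 k hk, h2]
        · exact fun h => ⟨fun k hk => h k (.inl hk), h m (.inr rfl)⟩
    exact this n

/-- Simulating a decider at all nodes of the labelled path with `i + 1` nodes would decide whether
`turingMachine i` halts. -/
theorem haltingPaths_notMem_LD : haltingPaths ∉ LD := by
  rintro ⟨A, hA⟩
  have hp : Computable₂ fun n v : ℕ => A.out (pathView A.radius n v) :=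
    A.computable.comp (primrec_pathView A.radius).to_comp
  obtain ⟨g, hg, hgi⟩ := computable_forall_lt hp
  refine not_computable_halts ⟨fun i => g (i + 1), hg.comp .succ, fun i => ?_⟩
  rw [hgi, ← labelledPath_mem_iff, hA _ Fin.valEmbedding]
  constructor
  · intro h v
    exact (congrArg A.out (labelledPath_view A.radius i v)).trans (h v v.isLt)
  · intro h k hk
    exact (congrArg A.out (labelledPath_view A.radius i ⟨k, hk⟩)).symm.trans (h ⟨k, hk⟩)

open Relation

/-! ### Programs run for a number of steps -/

/-- The output on input `0` within `k` steps of the program number `N`. -/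
def outputWithin (N k : ℕ) : Option ℕ := (Denumerable.ofNat Nat.Partrec.Code N).evaln k 0

theorem primrec_outputWithin : Primrec₂ outputWithin :=
  Nat.Partrec.Code.primrec_evaln.comp
    (.pair (.pair .snd (.comp (.ofNat _) .fst)) (.const 0))

theorem outputWithin_mono {N k k' y : ℕ} (h : k ≤ k') (hy : outputWithin N k = some y) :
    outputWithin N k' = some y :=
  Nat.Partrec.Code.evaln_mono h hy

/-- The program number `N` has the output `y` on input `0`. -/
def HasOutput (N y : ℕ) : Prop := y ∈ (Denumerable.ofNat Nat.Partrec.Code N).eval 0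

theorem hasOutput_iff {N y : ℕ} : HasOutput N y ↔ ∃ k, outputWithin N k = some y :=
  Nat.Partrec.Code.evaln_complete

theorem HasOutput.unique {N y y' : ℕ} (h : HasOutput N y) (h' : HasOutput N y') : y = y' :=
  Part.mem_unique h h'

/-! ### Locally grid-like graphs -/

/-- The local rule, at the node `v`, of a grid with rows `0, …, r` (and one more row if
`p = true` and the flag is `1`).  Only the nodes of row `0` know their column, only the nodes of
the rows from `r` on know the flag, and the program `N` halts within as many steps as there are
columns. -/
structure GridValid (p : Bool) {V : Type} (G : SimpleGraph V) (N r i b d : V → ℕ) (v : V) :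
    Prop where
  depth_pos : 1 ≤ r v
  row_le : i v ≤ r v ∨ (i v = r v + 1 ∧ p = true ∧ b v = 1)
  prog_eq : ∀ w, G.Adj v w → N w = N v
  depth_eq : ∀ w, G.Adj v w → r w = r v
  row_adj : ∀ w, G.Adj v w → i w = i v ∨ i w = i v + 1 ∨ i v = i w + 1
  flag_eq : ∀ w, G.Adj v w → r v ≤ i v → r v ≤ i w → b w = b v
  vert_unique : ∀ w, G.Adj v w → ∀ w', G.Adj v w' → i w = i w' → i w ≠ i v → w = w'
  down : 0 < i v → ∃ w, G.Adj v w ∧ i w + 1 = i v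
  up : (i v < r v ∨ (i v = r v ∧ p = true ∧ b v = 1)) → ∃ w, G.Adj v w ∧ i w = i v + 1
  lift : ∀ w, G.Adj v w → i w = i v → ∀ u, G.Adj v u → i u ≠ i v →
    ∃ u', G.Adj w u' ∧ i u' = i u ∧ G.Adj u u'
  col_adj : i v = 0 → ∀ w, G.Adj v w → i w = 0 → d w = d v + 1 ∨ d v = d w + 1
  col_unique : i v = 0 → ∀ w, G.Adj v w → ∀ w', G.Adj v w' → i w = 0 → i w' = 0 →
    d w = d w' → w = w'
  col_low : i v = 0 → 0 < d v → ∃ w, G.Adj v w ∧ i w = 0 ∧ d w + 1 = d v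
  last : i v = 0 → (∃ w, G.Adj v w ∧ i w = 0 ∧ d w = d v + 1) ∨
    ((d v + 1) % (r v + 1) = 1 ∧
      (outputWithin (N v) (d v)).isSome = true)

/-- The number of rows. -/
def gridHeight (p : Bool) (r b : ℕ) : ℕ := r + 1 + if p = true ∧ b = 1 then 1 else 0

/-- Connectedness passes to the terminal nodes of a partial function that is compatible with
the adjacency relation. -/
theorem reflTransGen_of_terminal {V : Type} {R s h : V → V → Prop}
    (runiq : ∀ {v w w'}, s v w → s v w' → w = w')
    (edge : ∀ {v w}, R v w → s v w ∨ s w v ∨ h v w)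
    (hsymm : ∀ {v w}, h v w → h w v)
    (lift : ∀ {v w v'}, h v w → s v v' → ∃ w', s w w' ∧ h v' w')
    {x y : V} (hxy : ReflTransGen R x y) (hx : ∀ z, ¬ s x z) (hy : ∀ z, ¬ s y z) :
    ReflTransGen h x y := by
  -- A horizontal step is transported along the whole vertical chain. The end of the new chain is
  -- terminal because `lift` also works backwards by symmetry of `h`.
  have horiz : ∀ {u v}, ReflTransGen s v u → (∀ z, ¬ s u z) → ∀ {w}, h v w →
      ∃ u', ReflTransGen s w u' ∧ (∀ z, ¬ s u' z) ∧ h u u' := by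
    intro u v hvu hu
    induction hvu using ReflTransGen.head_induction_on with
    | refl =>
      intro w hw
      refine ⟨w, .refl, fun z hz => ?_, hw⟩
      obtain ⟨v', hv', _⟩ := lift (hsymm hw) hz
      exact hu v' hv'
    | head hvv' _ ih =>
      intro w hw
      obtain ⟨w', hw', hh⟩ := lift hw hvv'
      obtain ⟨u', h1, h2, h3⟩ := ih hh
      exact ⟨u', .head hw' h1, h2, h3⟩
  -- Invariant along the walk: the vertical chain of `z` ends in a terminal node that is joined to
  -- `x` horizontally.
  have key : ∀ z, ReflTransGen R x z →
      ∃ u, ReflTransGen s z u ∧ (∀ t, ¬ s u t) ∧ ReflTransGen h x u := by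
    intro z hz
    induction hz with
    | refl => exact ⟨x, .refl, hx, .refl⟩
    | tail _ hyz ih =>
      obtain ⟨u, h1, h2, h3⟩ := ih
      rcases edge hyz with hs | hs | hh
      · rcases h1.cases_head with rfl | ⟨c, hc, hcu⟩
        · exact absurd hs (h2 _)
        · rw [runiq hs hc]
          exact ⟨u, hcu, h2, h3⟩
      · exact ⟨u, .head hs h1, h2, h3⟩
      · obtain ⟨u', k1, k2, k3⟩ := horiz h1 h2 hh
        exact ⟨u', k1, k2, h3.tail k3⟩
  obtain ⟨u, h1, h2, h3⟩ := key y hxy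
  rcases h1.cases_head with rfl | ⟨c, hc, _⟩
  · exact h3
  · exact absurd hc (hy c)

namespace GridValid

variable {p : Bool} {n : ℕ} {G : SimpleGraph (Fin n)} {N r i b d : Fin n → ℕ}

theorem prog_const (hG : G.Connected) (hv : ∀ v, GridValid p G N r i b d v) (v w : Fin n) :
    N v = N w := by
  induction hG.reflTransGen v w with
  | refl => rfl
  | tail _ h ih => rw [ih, (hv _).prog_eq _ h]

theorem depth_const (hG : G.Connected) (hv : ∀ v, GridValid p G N r i b d v) (v w : Fin n) :
    r v = r w := by
  induction hG.reflTransGen v w with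
  | refl => rfl
  | tail _ h ih => rw [ih, (hv _).depth_eq _ h]

/-- The flag is compared only along edges between rows from `r` on. Projecting a walk upwards to
terminal nodes gives a walk inside these rows, along which the flag is constant. -/
theorem flag_const (hG : G.Connected) (hv : ∀ v, GridValid p G N r i b d v) {v w : Fin n}
    (h1 : r v ≤ i v) (h2 : r w ≤ i w) : b v = b w := by
  let s : Fin n → Fin n → Prop := fun v w => G.Adj v w ∧ i w = i v + 1
  let h : Fin n → Fin n → Prop := fun v w => G.Adj v w ∧ i w = i v
  have hdep := fun v w => depth_const hG hv v w
  have hterm : ∀ v, (∀ z, ¬ s v z) → r v ≤ i v := by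
    intro v hs
    by_contra hlt
    obtain ⟨w, hw⟩ := (hv v).up (.inl (by omega))
    exact hs w hw
  -- Above row `r` there is at most one more row, so one step up is enough to reach a terminal node.
  have htop : ∀ v, r v ≤ i v → ∃ t, (∀ z, ¬ s t z) ∧ b t = b v := by
    intro v hr
    by_cases hs : ∀ z, ¬ s v z
    · exact ⟨v, hs, rfl⟩
    · push Not at hs
      obtain ⟨w, hw, hiw⟩ := hs
      refine ⟨w, fun z hz => ?_, (hv v).flag_eq w hw hr (by omega)⟩
      have := hz.2
      have := (hv z).row_le
      have := hdep v z
      omega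
  obtain ⟨t, ht, hbt⟩ := htop v h1
  obtain ⟨t', ht', hbt'⟩ := htop w h2
  rw [← hbt, ← hbt']
  have hconn : ReflTransGen h t t' := by
    refine reflTransGen_of_terminal (R := G.Adj) (s := s) (h := h) ?_ ?_ ?_ ?_
      (hG.reflTransGen t t') ht ht'
    · intro v w w' h1 h2
      exact (hv v).vert_unique w h1.1 w' h2.1 (by rw [h1.2, h2.2]) (by have := h1.2; omega)
    · intro v w hvw
      rcases (hv v).row_adj w hvw with h | h | h
      · exact .inr (.inr ⟨hvw, h⟩)
      · exact .inl ⟨hvw, h⟩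
      · exact .inr (.inl ⟨hvw.symm, h⟩)
    · exact fun h => ⟨h.1.symm, h.2.symm⟩
    · intro v w v' h1 h2
      obtain ⟨u, hu1, hu2, hu3⟩ := (hv v).lift w h1.1 h1.2 v' h2.1 (by have := h2.2; omega)
      refine ⟨u, ⟨hu1, ?_⟩, hu3, hu2⟩
      have := h1.2
      have := h2.2
      omega
  have hr : ∀ z, ReflTransGen h t z → r z ≤ i z ∧ b t = b z := by
    intro z hz
    induction hz with
    | refl => exact ⟨hterm t ht, rfl⟩
    | @tail y z _ hyz ih =>
      have e1 := hdep y z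
      have e2 := hyz.2
      refine ⟨by omega, ?_⟩
      rw [ih.2]
      exact ((hv y).flag_eq z hyz.1 ih.1 (by omega)).symm
  exact (hr t' hconn).2

theorem exists_row_zero (hv : ∀ v, GridValid p G N r i b d v) (v : Fin n) : ∃ w, i w = 0 := by
  have : ∀ k v, i v = k → ∃ w, i w = 0 := by
    intro k
    induction k with
    | zero => exact fun v h => ⟨v, h⟩
    | succ k ih =>
      intro v h
      obtain ⟨w, _, hw⟩ := (hv v).down (by omega)
      exact ih w (by omega)
  exact this _ v rfl

/-- Row `0` is a path, numbered by the columns. -/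
theorem row_zero (hG : G.Connected) (hv : ∀ v, GridValid p G N r i b d v) :
    ∃ v, i v = 0 ∧ (d v + 1) % (r v + 1) = 1 ∧
      (outputWithin (N v) (d v)).isSome = true ∧
      (Finset.univ.filter fun v => i v = 0).card = d v + 1 := by
  classical
  let s : Fin n → Fin n → Prop := fun v w => G.Adj v w ∧ i w + 1 = i v
  let h : Fin n → Fin n → Prop := fun v w => G.Adj v w ∧ i w = i v
  have hs : ∀ x : Fin n, i x = 0 → ∀ z, ¬ s x z := fun x hx z hz => by
    have := hz.2
    omega
  -- Projecting walks downwards shows that row `0` is connected by itself.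
  have hproj : ∀ x y : Fin n, i x = 0 → i y = 0 → ReflTransGen h x y := by
    intro x y hx hy
    refine reflTransGen_of_terminal (R := G.Adj) (s := s) (h := h) ?_ ?_ ?_ ?_
      (hG.reflTransGen x y) (hs x hx) (hs y hy)
    · intro v w w' h1 h2
      exact (hv v).vert_unique w h1.1 w' h2.1 (by have := h1.2; have := h2.2; omega)
        (by have := h1.2; omega)
    · intro v w hvw
      rcases (hv v).row_adj w hvw with h | h | h
      · exact .inr (.inr ⟨hvw, h⟩)
      · exact .inr (.inl ⟨hvw.symm, h.symm⟩)
      · exact .inl ⟨hvw, h.symm⟩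
    · exact fun h => ⟨h.1.symm, h.2.symm⟩
    · intro v w v' h1 h2
      obtain ⟨u, hu1, hu2, hu3⟩ := (hv v).lift w h1.1 h1.2 v' h2.1 (by have := h2.2; omega)
      refine ⟨u, ⟨hu1, ?_⟩, hu3, hu2⟩
      have := h1.2
      have := h2.2
      omega
  let X := {v : Fin n // i v = 0}
  let R : X → X → Prop := fun x y => G.Adj x y
  have hconn : ∀ x y : X, ReflTransGen R x y := by
    rintro ⟨x, hx⟩ ⟨y, hy⟩
    have : ∀ z, ReflTransGen h x z → ∃ hz : i z = 0, ReflTransGen R ⟨x, hx⟩ ⟨z, hz⟩ := by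
      intro z hz
      induction hz with
      | refl => exact ⟨hx, .refl⟩
      | tail _ hyz ih =>
        obtain ⟨h0, hr⟩ := ih
        exact ⟨by rw [hyz.2, h0], hr.tail hyz.1⟩
    exact (this y (hproj x y hx hy)).2
  let f : X → ℕ := fun x => d x
  have hinj : Function.Injective f := by
    refine injective_of_locally_path (R := R) hconn (fun _ _ h => h.symm) ?_ ?_ ?_
    · exact fun x y hxy => (hv x).col_adj x.2 y hxy y.2
    · exact fun x y y' h1 h2 h3 => Subtype.ext ((hv x).col_unique x.2 y h1 y' h2 y.2 y'.2 h3)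
    · intro x hx
      obtain ⟨w, h1, h2, h3⟩ := (hv x).col_low x.2 hx
      exact ⟨⟨w, h2⟩, h1, h3⟩
  obtain ⟨v₀⟩ := hG.nonempty
  obtain ⟨w₀, hw₀⟩ := exists_row_zero hv v₀
  have : Nonempty X := ⟨⟨w₀, hw₀⟩⟩
  obtain ⟨x, hmax, hcard⟩ := exists_card_eq_of_injective hinj fun x hx => by
    obtain ⟨w, h1, h2, h3⟩ := (hv x).col_low x.2 hx
    exact ⟨⟨w, h2⟩, h3⟩
  refine ⟨x, x.2, ?_⟩
  -- The node with the largest column has no right neighbour, so it must satisfy the certificate on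
  -- the width and the halting time.
  rcases (hv x).last x.2 with ⟨w, _, h2, h3⟩ | ⟨h1, h2⟩
  · have := hmax ⟨w, h2⟩
    simp only [f] at this
    omega
  · refine ⟨h1, h2, ?_⟩
    rw [← Fintype.card_subtype]
    exact hcard

/-- The vertical edges form a perfect matching between the two rows: each node has at most one
neighbour in a given adjacent row, and `up` and `down` provide one. -/
theorem card_row_succ (hv : ∀ v, GridValid p G N r i b d v) {k : ℕ}
    (hk : ∀ v, i v = k → i v < r v ∨ (i v = r v ∧ p = true ∧ b v = 1)) :
    (Finset.univ.filter fun v => i v = k).card = (Finset.univ.filter fun v => i v = k + 1).card := by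
  have hup : ∀ v, i v = k → ∃ w, G.Adj v w ∧ i w = k + 1 := fun v h => by
    obtain ⟨w, h1, h2⟩ := (hv v).up (hk v h)
    exact ⟨w, h1, by omega⟩
  choose! f hf using hup
  refine Finset.card_bij (fun v _ => f v) ?_ ?_ ?_
  · intro v h
    simp only [Finset.mem_filter, Finset.mem_univ, true_and] at h ⊢
    exact (hf v h).2
  · intro v h w h' he
    simp only [Finset.mem_filter, Finset.mem_univ, true_and] at h h'
    have h1 := hf v h
    have h2 := hf w h'
    rw [← he] at h2
    exact (hv (f v)).vert_unique v h1.1.symm w h2.1.symm (by omega) (by omega)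
  · intro w h
    simp only [Finset.mem_filter, Finset.mem_univ, true_and] at h
    obtain ⟨v, h1, h2⟩ := (hv w).down (by omega)
    have h3 : i v = k := by omega
    refine ⟨v, by simpa using h3, ?_⟩
    have h4 := hf v h3
    exact (hv v).vert_unique _ h4.1 w h1.symm (by omega) (by omega)

/-- The size of a locally grid-like graph. -/
theorem exists_width (hG : G.Connected) (hv : ∀ v, GridValid p G N r i b d v) (v₀ : Fin n) :
    ∃ v₁ W, r v₁ ≤ i v₁ ∧ 0 < W ∧ W % (r v₀ + 1) = 1 ∧
      (outputWithin (N v₀) (W - 1)).isSome = true ∧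
      (Finset.univ.filter fun v => r v ≤ i v).card ≥ W ∧
      n = W * gridHeight p (r v₀) (b v₁) := by
  classical
  obtain ⟨z, hz, hmod, hhalt, hcard⟩ := row_zero hG hv
  have hdep := fun v => depth_const hG hv v v₀
  rw [hdep z] at hmod
  rw [prog_const hG hv z v₀] at hhalt
  have hrow : ∀ k ≤ r v₀, (Finset.univ.filter fun v => i v = k).card = d z + 1 := by
    intro k
    induction k with
    | zero => exact fun _ => hcard
    | succ k ih =>
      intro hk
      rw [← card_row_succ hv, ih (by omega)]
      intro v hvk
      left
      rw [hdep v]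
      omega
  have hpos : 0 < (Finset.univ.filter fun v => i v = r v₀).card := by
    rw [hrow _ le_rfl]; omega
  obtain ⟨v₁, hv₁⟩ := Finset.card_pos.1 hpos
  simp only [Finset.mem_filter, Finset.mem_univ, true_and] at hv₁
  have hv₁' : r v₁ ≤ i v₁ := by rw [hdep, hv₁]
  have hflag : ∀ v, r v ≤ i v → b v = b v₁ := fun v h => flag_const hG hv h hv₁'
  refine ⟨v₁, d z + 1, hv₁', by omega, hmod, hhalt, ?_, ?_⟩
  · rw [← hrow _ le_rfl]
    refine Finset.card_le_card fun v h => ?_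
    simp only [Finset.mem_filter, Finset.mem_univ, true_and] at h ⊢
    rw [hdep, h]
  · have hall : ∀ k ∈ Finset.range (gridHeight p (r v₀) (b v₁)),
        (Finset.univ.filter fun v => i v = k).card = d z + 1 := by
      intro k hk
      rw [Finset.mem_range, gridHeight] at hk
      by_cases hkr : k ≤ r v₀
      · exact hrow k hkr
      · split_ifs at hk with hp
        · obtain rfl : k = r v₀ + 1 := by omega
          rw [← card_row_succ hv, hrow _ le_rfl]
          intro v hvk
          right
          refine ⟨by rw [hvk, hdep v], hp.1, ?_⟩
          rw [hflag v (by rw [hdep, hvk]), hp.2]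
        · omega
    have hmaps : ∀ v ∈ (Finset.univ : Finset (Fin n)),
        i v ∈ Finset.range (gridHeight p (r v₀) (b v₁)) := by
      intro v _
      rw [Finset.mem_range, gridHeight]
      rcases (hv v).row_le with h | ⟨h1, h2, h3⟩
      · rw [hdep] at h; omega
      · rw [if_pos ⟨h2, by rw [← hflag v (by omega), h3]⟩]
        rw [hdep] at h1
        omega
    -- The nodes are counted row by row; each of the `gridHeight` rows has `d z + 1` nodes.
    have hsum := Finset.card_eq_sum_card_fiberwise hmaps
    rw [Finset.sum_congr rfl hall, Finset.card_univ, Fintype.card_fin, Finset.sum_const,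
      Finset.card_range, smul_eq_mul, mul_comm] at hsum
    exact hsum

end GridValid

/-! ### Labels of grids -/

/-- Program, depth, row, flag and column. -/
abbrev GridData : Type := ℕ × ℕ × ℕ × ℕ × ℕ

/-- The data in a label. -/
def gridData (x : List Bool) : GridData := Denumerable.ofNat GridData x.length

/-- The label with given data. -/
def gridLabel (t : GridData) : List Bool := List.replicate (Encodable.encode t) true

theorem gridData_gridLabel (t : GridData) : gridData (gridLabel t) = t := by
  rw [gridData, gridLabel, List.length_replicate, Denumerable.ofNat_encode]

theorem primrec_gridData : Primrec gridData := (Primrec.ofNat _).comp .list_length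

theorem primrec_gridLabel : Primrec gridLabel := (primrec_replicate true).comp .encode

def gridProg (x : List Bool) : ℕ := (gridData x).1
def gridDepth (x : List Bool) : ℕ := (gridData x).2.1
def gridRow (x : List Bool) : ℕ := (gridData x).2.2.1
def gridFlag (x : List Bool) : ℕ := (gridData x).2.2.2.1
def gridCol (x : List Bool) : ℕ := (gridData x).2.2.2.2

theorem primrec_gridProg : Primrec gridProg := Primrec.fst.comp primrec_gridData
theorem primrec_gridDepth : Primrec gridDepth :=
  (Primrec.fst.comp .snd).comp primrec_gridData
theorem primrec_gridRow : Primrec gridRow :=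
  (Primrec.fst.comp (.comp .snd .snd)).comp primrec_gridData
theorem primrec_gridFlag : Primrec gridFlag :=
  (Primrec.fst.comp (.comp .snd (.comp .snd .snd))).comp primrec_gridData
theorem primrec_gridCol : Primrec gridCol :=
  (Primrec.snd.comp (.comp .snd (.comp .snd .snd))).comp primrec_gridData

/-! ### The local rule as a predicate on views -/

section Rule

variable {α : Type} (p : Bool) (l : α → List Bool)

/-- The rule of `GridValid` at an entry of a view. -/
def GridRule (V : View α) (x : ViewEntry α) : Prop :=
  1 ≤ gridDepth (l x.2.1) ∧
  (gridRow (l x.2.1) ≤ gridDepth (l x.2.1) ∨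
    (gridRow (l x.2.1) = gridDepth (l x.2.1) + 1 ∧ p = true ∧ gridFlag (l x.2.1) = 1)) ∧
  (∀ w ∈ V.nbrs x, gridProg (l w.2.1) = gridProg (l x.2.1)) ∧
  (∀ w ∈ V.nbrs x, gridDepth (l w.2.1) = gridDepth (l x.2.1)) ∧
  (∀ w ∈ V.nbrs x, gridRow (l w.2.1) = gridRow (l x.2.1) ∨
    gridRow (l w.2.1) = gridRow (l x.2.1) + 1 ∨ gridRow (l x.2.1) = gridRow (l w.2.1) + 1) ∧
  (∀ w ∈ V.nbrs x, gridDepth (l x.2.1) ≤ gridRow (l x.2.1) →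
    gridDepth (l x.2.1) ≤ gridRow (l w.2.1) → gridFlag (l w.2.1) = gridFlag (l x.2.1)) ∧
  (∀ w ∈ V.nbrs x, ∀ w' ∈ V.nbrs x, gridRow (l w.2.1) = gridRow (l w'.2.1) →
    gridRow (l w.2.1) ≠ gridRow (l x.2.1) → w.1 = w'.1) ∧
  (0 < gridRow (l x.2.1) → ∃ w ∈ V.nbrs x, gridRow (l w.2.1) + 1 = gridRow (l x.2.1)) ∧
  ((gridRow (l x.2.1) < gridDepth (l x.2.1) ∨
      (gridRow (l x.2.1) = gridDepth (l x.2.1) ∧ p = true ∧ gridFlag (l x.2.1) = 1)) →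
    ∃ w ∈ V.nbrs x, gridRow (l w.2.1) = gridRow (l x.2.1) + 1) ∧
  (∀ w ∈ V.nbrs x, gridRow (l w.2.1) = gridRow (l x.2.1) →
    ∀ u ∈ V.nbrs x, gridRow (l u.2.1) ≠ gridRow (l x.2.1) →
      ∃ u' ∈ V.nbrs w, gridRow (l u'.2.1) = gridRow (l u.2.1) ∧ u'.1 ∈ u.2.2) ∧
  (gridRow (l x.2.1) = 0 → ∀ w ∈ V.nbrs x, gridRow (l w.2.1) = 0 →
    gridCol (l w.2.1) = gridCol (l x.2.1) + 1 ∨ gridCol (l x.2.1) = gridCol (l w.2.1) + 1) ∧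
  (gridRow (l x.2.1) = 0 → ∀ w ∈ V.nbrs x, ∀ w' ∈ V.nbrs x, gridRow (l w.2.1) = 0 →
    gridRow (l w'.2.1) = 0 → gridCol (l w.2.1) = gridCol (l w'.2.1) → w.1 = w'.1) ∧
  (gridRow (l x.2.1) = 0 → 0 < gridCol (l x.2.1) →
    ∃ w ∈ V.nbrs x, gridRow (l w.2.1) = 0 ∧ gridCol (l w.2.1) + 1 = gridCol (l x.2.1)) ∧
  (gridRow (l x.2.1) = 0 →
    (∃ w ∈ V.nbrs x, gridRow (l w.2.1) = 0 ∧ gridCol (l w.2.1) = gridCol (l x.2.1) + 1) ∨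
    ((gridCol (l x.2.1) + 1) % (gridDepth (l x.2.1) + 1) = 1 ∧
      (outputWithin (gridProg (l x.2.1)) (gridCol (l x.2.1))).isSome = true))

variable {p l}

/-- Radius `2` is needed for `lift` only, which looks at neighbours of neighbours. -/
theorem gridRule_iff (G : LabelledGraph α) (ids : Fin G.n ↪ ℕ) (v : Fin G.n) :
    GridRule p l (G.view ids 2 v) (G.entry ids 2 v v) ↔
      GridValid p G.graph (fun u => gridProg (l (G.label u))) (fun u => gridDepth (l (G.label u)))
        (fun u => gridRow (l (G.label u))) (fun u => gridFlag (l (G.label u)))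
        (fun u => gridCol (l (G.label u))) v := by
  have h0 : G.graph.dist v v + 1 ≤ 2 := by simp
  have h1 : ∀ w, G.graph.Adj v w → G.graph.dist v w + 1 ≤ 2 := fun w hw => by
    rw [SimpleGraph.dist_eq_one_iff_adj.2 hw]
  have hlift : ∀ w, G.graph.Adj v w → ∀ u,
      ((∃ u' ∈ View.nbrs (G.view ids 2 v) (G.entry ids 2 v w),
        gridRow (l u'.2.1) = gridRow (l (G.label u)) ∧ u'.1 ∈ (G.entry ids 2 v u).2.2) ↔
      ∃ u', G.graph.Adj w u' ∧ gridRow (l (G.label u')) = gridRow (l (G.label u)) ∧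
        G.graph.Adj u u') := by
    intro w hw u
    rw [G.exists_nbrs ids 2 v (h1 w hw)]
    refine exists_congr fun u' => and_congr_right fun hu' => and_congr_right fun _ => ?_
    exact G.entry_adj ids 2 v (le_trans (G.dist_le_succ_of_adj le_rfl hu') (h1 w hw))
  unfold GridRule
  simp only [G.forall_nbrs ids 2 v h0, G.exists_nbrs ids 2 v h0,
    LabelledGraph.entry_label, LabelledGraph.entry_fst_eq]
  constructor
  · rintro ⟨a1, a2, a3, a4, a5, a6, a7, a8, a9, a10, a11, a12, a13, a14⟩
    exact ⟨a1, a2, a3, a4, a5, a6, a7, a8, a9,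
      fun w hw e u hu e' => (hlift w hw u).1 (a10 w hw e u hu e'), a11, a12, a13, a14⟩
  · rintro ⟨a1, a2, a3, a4, a5, a6, a7, a8, a9, a10, a11, a12, a13, a14⟩
    exact ⟨a1, a2, a3, a4, a5, a6, a7, a8, a9,
      fun w hw e u hu e' => (hlift w hw u).2 (a10 w hw e u hu e'), a11, a12, a13, a14⟩

theorem primrecPred_gridRule [Primcodable α] (hl : Primrec l) :
    PrimrecPred fun z : View α × ViewEntry α => GridRule p l z.1 z.2 := by
  have lab : Primrec fun x : ViewEntry α => l x.2.1 := hl.comp (Primrec.fst.comp Primrec.snd)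
  have N := primrec_gridProg.comp lab
  have r := primrec_gridDepth.comp lab
  have i := primrec_gridRow.comp lab
  have b := primrec_gridFlag.comp lab
  have d := primrec_gridCol.comp lab
  have nb : Primrec fun z : View α × ViewEntry α => z.1.nbrs z.2 := View.primrec_nbrs
  -- the entries `x` and `w` in a context `((V, x), w)`
  have X : Primrec fun z : (View α × ViewEntry α) × ViewEntry α => z.1.2 := .comp .snd .fst
  have W : Primrec fun z : (View α × ViewEntry α) × ViewEntry α => z.2 := .snd
  -- the entries `x`, `w`, `u` in a context `(((V, x), w), u)`
  have X' : Primrec fun z : ((View α × ViewEntry α) × ViewEntry α) × ViewEntry α => z.1.1.2 :=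
    X.comp .fst
  have W' : Primrec fun z : ((View α × ViewEntry α) × ViewEntry α) × ViewEntry α => z.1.2 :=
    W.comp .fst
  have U' : Primrec fun z : ((View α × ViewEntry α) × ViewEntry α) × ViewEntry α => z.2 := .snd
  have row0 : PrimrecPred fun z : View α × ViewEntry α => gridRow (l z.2.2.1) = 0 :=
    Primrec.eq.comp (i.comp .snd) (.const 0)
  unfold GridRule
  refine .and ?_ (.and ?_ (.and ?_ (.and ?_ (.and ?_ (.and ?_ (.and ?_ (.and ?_ (.and ?_
    (.and ?_ (.and ?_ (.and ?_ (.and ?_ ?_))))))))))))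
  · exact Primrec.nat_le.comp (.const 1) (r.comp .snd)
  · exact .or (Primrec.nat_le.comp (i.comp .snd) (r.comp .snd))
      (.and (Primrec.eq.comp (i.comp .snd) (Primrec.succ.comp (r.comp .snd)))
        (.and (.const _) (Primrec.eq.comp (b.comp .snd) (.const 1))))
  · exact .forall_mem nb (Primrec.eq.comp (N.comp W) (N.comp X))
  · exact .forall_mem nb (Primrec.eq.comp (r.comp W) (r.comp X))
  · exact .forall_mem nb (.or (Primrec.eq.comp (i.comp W) (i.comp X))
      (.or (Primrec.eq.comp (i.comp W) (Primrec.succ.comp (i.comp X)))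
        (Primrec.eq.comp (i.comp X) (Primrec.succ.comp (i.comp W)))))
  · exact .forall_mem nb (.imp (Primrec.nat_le.comp (r.comp X) (i.comp X))
      (.imp (Primrec.nat_le.comp (r.comp X) (i.comp W)) (Primrec.eq.comp (b.comp W) (b.comp X))))
  · exact .forall_mem nb (.forall_mem (nb.comp .fst) (.imp
      (Primrec.eq.comp (i.comp W') (i.comp U')) (.imp
        (PrimrecPred.not (Primrec.eq.comp (i.comp W') (i.comp X')))
        (Primrec.eq.comp (Primrec.fst.comp W') (Primrec.fst.comp U')))))
  · exact .imp (Primrec.nat_lt.comp (.const 0) (i.comp .snd)) (.exists_mem nb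
      (Primrec.eq.comp (Primrec.succ.comp (i.comp W)) (i.comp X)))
  · exact .imp (.or (Primrec.nat_lt.comp (i.comp .snd) (r.comp .snd))
      (.and (Primrec.eq.comp (i.comp .snd) (r.comp .snd))
        (.and (.const _) (Primrec.eq.comp (b.comp .snd) (.const 1)))))
      (.exists_mem nb (Primrec.eq.comp (i.comp W) (Primrec.succ.comp (i.comp X))))
  · refine .forall_mem nb (.imp (Primrec.eq.comp (i.comp W) (i.comp X))
      (.forall_mem (nb.comp .fst) (.imp
        (PrimrecPred.not (Primrec.eq.comp (i.comp U') (i.comp X')))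
        (.exists_mem (View.primrec_nbrs.comp (.comp .fst (.comp .fst .fst)) W') (.and
          (Primrec.eq.comp (i.comp .snd) (i.comp (U'.comp .fst)))
          (.mem (.comp .fst .snd) (Primrec.snd.comp (Primrec.snd.comp (U'.comp .fst)))))))))
  · exact .imp row0 (.forall_mem nb (.imp (Primrec.eq.comp (i.comp W) (.const 0))
      (.or (Primrec.eq.comp (d.comp W) (Primrec.succ.comp (d.comp X)))
        (Primrec.eq.comp (d.comp X) (Primrec.succ.comp (d.comp W))))))
  · exact .imp row0 (.forall_mem nb (.forall_mem (nb.comp .fst) (.imp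
      (Primrec.eq.comp (i.comp W') (.const 0)) (.imp (Primrec.eq.comp (i.comp U') (.const 0))
        (.imp (Primrec.eq.comp (d.comp W') (d.comp U'))
          (Primrec.eq.comp (Primrec.fst.comp W') (Primrec.fst.comp U')))))))
  · exact .imp row0 (.imp (Primrec.nat_lt.comp (.const 0) (d.comp .snd)) (.exists_mem nb
      (.and (Primrec.eq.comp (i.comp W) (.const 0))
        (Primrec.eq.comp (Primrec.succ.comp (d.comp W)) (d.comp X)))))
  · refine .imp row0 (.or (.exists_mem nb
      (.and (Primrec.eq.comp (i.comp W) (.const 0))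
        (Primrec.eq.comp (d.comp W) (Primrec.succ.comp (d.comp X))))) (.and ?_ ?_))
    · exact Primrec.eq.comp (Primrec.nat_mod.comp (Primrec.succ.comp (d.comp .snd))
        (Primrec.succ.comp (r.comp .snd))) (.const 1)
    · exact Primrec.eq.comp (Primrec.option_isSome.comp
        (primrec_outputWithin.comp (N.comp .snd) (d.comp .snd))) (.const true)

end Rule

/-! ### The grid languages -/

/-- The node rule of the grids, read in a labelled graph. -/
abbrev LabelledGraph.IsGridAt {α : Type} (p : Bool) (l : α → List Bool) (G : LabelledGraph α)
    (v : Fin G.n) : Prop :=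
  GridValid p G.graph (fun u => gridProg (l (G.label u))) (fun u => gridDepth (l (G.label u)))
    (fun u => gridRow (l (G.label u))) (fun u => gridFlag (l (G.label u)))
    (fun u => gridCol (l (G.label u))) v

/-- The locally grid-like graphs that do not have both the flag `1` and a program with
output `1`. -/
def gridLanguage (p : Bool) : DistributedLanguage :=
  {G | (∀ v, G.IsGridAt p id v) ∧ ¬ ∃ v, gridDepth (G.label v) ≤ gridRow (G.label v) ∧
    gridFlag (G.label v) = 1 ∧ HasOutput (gridProg (G.label v)) 1}

/-- If a program halts within `k` steps and has output `1`, then its output is known by then. -/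
theorem outputWithin_eq_one {N k k' : ℕ} (h : HasOutput N 1)
    (hk : (outputWithin N k).isSome = true) (hkk : k ≤ k') : outputWithin N k' = some 1 := by
  obtain ⟨y, hy⟩ := Option.isSome_iff_exists.1 hk
  rw [h.unique (hasOutput_iff.2 ⟨k, hy⟩)]
  exact outputWithin_mono hkk hy

open Classical in
/-- The algorithm that checks the grid rule and runs the program as long as the identifiers
allow. -/
noncomputable def gridAlgorithm (p : Bool) : LocalAlgorithm (List Bool) where
  radius := 2
  out V := decide (∀ x ∈ V.center, GridRule p id V x ∧ (gridDepth x.2.1 ≤ gridRow x.2.1 →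
    gridFlag x.2.1 = 1 → outputWithin (gridProg x.2.1) x.1 ≠ some 1))
  computable := by
    have l : Primrec fun z : View (List Bool) × ViewEntry (List Bool) => z.2.2.1 :=
      Primrec.fst.comp (Primrec.snd.comp .snd)
    refine (PrimrecPred.forall_mem View.primrec_center
      (.and (primrecPred_gridRule Primrec.id) ?_)).computable_decide
    exact .imp (Primrec.nat_le.comp (primrec_gridDepth.comp l) (primrec_gridRow.comp l))
      (.imp (Primrec.eq.comp (primrec_gridFlag.comp l) (.const 1))
        (PrimrecPred.not (Primrec.eq.comp (primrec_outputWithin.comp (primrec_gridProg.comp l)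
          (Primrec.fst.comp .snd)) (.const (some 1)))))

theorem gridAlgorithm_out (p : Bool) (G : LabelledGraph (List Bool)) (ids : Fin G.n ↪ ℕ)
    (v : Fin G.n) : (gridAlgorithm p).out (G.view ids (gridAlgorithm p).radius v) = true ↔
      G.IsGridAt p id v ∧ (gridDepth (G.label v) ≤ gridRow (G.label v) →
        gridFlag (G.label v) = 1 → outputWithin (gridProg (G.label v)) (ids v) ≠ some 1) := by
  simp only [gridAlgorithm, decide_eq_true_eq]
  rw [LabelledGraph.forall_center, gridRule_iff]
  rfl

/-- A false alarm cannot occur, since a finite run shows a true output. A violation is not missed: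
distinct identifiers on `W` nodes aware of the flag include one that is at least `W - 1`, and by
then `N` has halted. -/
theorem gridLanguage_mem_LD (p : Bool) : gridLanguage p ∈ LD := by
  classical
  refine ⟨gridAlgorithm p, fun G ids => ?_⟩
  simp only [LocalAlgorithm.Accepts, gridAlgorithm_out]
  constructor
  · rintro ⟨hv, hbad⟩ v
    exact ⟨hv v, fun h1 h2 h3 => hbad ⟨v, h1, h2, hasOutput_iff.2 ⟨_, h3⟩⟩⟩
  · intro h
    have hv : ∀ v, G.IsGridAt p id v := fun v => (h v).1
    refine ⟨hv, ?_⟩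
    rintro ⟨v, h1, h2, h3⟩
    obtain ⟨v₁, W, _, hW, _, hhalt, hcard, _⟩ := GridValid.exists_width G.connected hv v
    obtain ⟨u, hu, hid⟩ : ∃ u ∈ Finset.univ.filter
        (fun u => gridDepth (G.label u) ≤ gridRow (G.label u)), W - 1 ≤ ids u := by
      by_contra hcon
      push Not at hcon
      have hsub : (Finset.univ.filter
          (fun u => gridDepth (G.label u) ≤ gridRow (G.label u))).image ids
            ⊆ Finset.range (W - 1) := by
        intro k hk
        obtain ⟨u, hu, rfl⟩ := Finset.mem_image.1 hk
        exact Finset.mem_range.2 (hcon u hu)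
      have := Finset.card_le_card hsub
      rw [Finset.card_image_of_injective _ ids.injective, Finset.card_range] at this
      have hcard' : W ≤ (Finset.univ.filter
        (fun u => gridDepth (G.label u) ≤ gridRow (G.label u))).card := hcard
      omega
    have hu' := (Finset.mem_filter.1 hu).2
    have hflag : gridFlag (G.label u) = gridFlag (G.label v) :=
      GridValid.flag_const G.connected hv hu' h1
    have hprog : gridProg (G.label u) = gridProg (G.label v) :=
      GridValid.prog_const G.connected hv u v
    refine (h u).2 hu' (hflag.trans h2) ?_
    rw [hprog]
    exact outputWithin_eq_one h3 hhalt hid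

/-- The rule of the node that knows the number `k` of nodes: the number of rows shows the flag. -/
def SizeRule (x : List Bool) (k : ℕ) : Prop :=
  2 ≤ k → k % (gridDepth x + 1) = 1 → outputWithin (gridProg x) k ≠ some 1

open Classical in
/-- The algorithm that checks the grid rule and runs the program for as many steps as there are
nodes, where the oracle tells this number. -/
noncomputable def gridOracleAlgorithm : LocalAlgorithm (List Bool × List Bool) where
  radius := 2
  out V := decide (∀ x ∈ V.center, GridRule true Prod.fst V x ∧
    SizeRule x.2.1.1 x.2.1.2.length)
  computable := by
    have l : Primrec fun z : View (List Bool × List Bool) × ViewEntry (List Bool × List Bool) =>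
      z.2.2.1.1 := Primrec.fst.comp (Primrec.fst.comp (Primrec.snd.comp .snd))
    have k : Primrec fun z : View (List Bool × List Bool) × ViewEntry (List Bool × List Bool) =>
      z.2.2.1.2.length :=
      Primrec.list_length.comp (Primrec.snd.comp (Primrec.fst.comp (Primrec.snd.comp .snd)))
    refine (PrimrecPred.forall_mem View.primrec_center
      (.and (primrecPred_gridRule Primrec.fst) ?_)).computable_decide
    exact .imp (Primrec.nat_le.comp (.const 2) k)
      (.imp (Primrec.eq.comp (Primrec.nat_mod.comp k (Primrec.succ.comp
        (primrec_gridDepth.comp l))) (.const 1))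
        (PrimrecPred.not (Primrec.eq.comp (primrec_outputWithin.comp (primrec_gridProg.comp l) k)
          (.const (some 1)))))

theorem gridOracleAlgorithm_out (G : LabelledGraph (List Bool × List Bool)) (ids : Fin G.n ↪ ℕ)
    (v : Fin G.n) : gridOracleAlgorithm.out (G.view ids gridOracleAlgorithm.radius v) = true ↔
      G.IsGridAt true Prod.fst v ∧ SizeRule (G.label v).1 (G.label v).2.length := by
  simp only [gridOracleAlgorithm, decide_eq_true_eq]
  rw [LabelledGraph.forall_center, gridRule_iff]
  rfl

/-- The holder of the last oracle label knows `n`. As `n` is a multiple of `r + 1` unless the flag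
is `1`, its residue shows the flag; and `n ≥ W` is a sufficient time bound. -/
theorem gridLanguage_mem_LDOWith : gridLanguage true ∈ LDOWith haltingOracle := by
  refine ⟨gridOracleAlgorithm, fun G ids ids' v => ?_, fun G π ids => ?_⟩
  · rw [Bool.eq_iff_iff, gridOracleAlgorithm_out, gridOracleAlgorithm_out]
  have hout : gridOracleAlgorithm.Accepts (G.withOracle haltingOracle π) ids ↔
      ∀ v : Fin G.n, G.IsGridAt true id v ∧
        SizeRule (G.label v) (haltingOracle.label G.n (π v)).length :=
    forall_congr' fun v => gridOracleAlgorithm_out _ ids v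
  rw [hout]
  constructor
  · rintro ⟨hv, hbad⟩ v
    refine ⟨hv v, fun hk hmod hone => ?_⟩
    -- The bound `2 ≤ k` silences the holders of `[false]`, whose length `1` would have the
    -- suspicious residue.
    have hπ : (π v : ℕ) + 1 = G.n := by
      by_contra hne
      rw [haltingOracle_label_of_lt hne] at hk
      simp at hk
    rw [haltingOracle_label_of_eq hπ, length_haltingBits] at hmod hone
    obtain ⟨v₁, W, hv₁, _, _, _, _, hn⟩ := GridValid.exists_width G.connected hv v
    refine hbad ⟨v₁, hv₁, ?_, ?_⟩
    · by_contra hb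
      have hb' : ¬ (true = true ∧ gridFlag (id (G.label v₁)) = 1) := fun h => hb h.2
      rw [gridHeight, if_neg hb', add_zero] at hn
      rw [hn] at hmod
      simp at hmod
    · have hprog : gridProg (G.label v₁) = gridProg (G.label v) :=
        GridValid.prog_const G.connected hv v₁ v
      rw [hprog]
      exact hasOutput_iff.2 ⟨_, hone⟩
  · intro h
    have hv : ∀ v, G.IsGridAt true id v := fun v => (h v).1
    refine ⟨hv, ?_⟩
    rintro ⟨v, h1, h2, h3⟩
    obtain ⟨u, hu⟩ := exists_perm_eq_last G.n_pos π
    have hsize := (h u).2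
    rw [haltingOracle_label_of_eq hu, length_haltingBits] at hsize
    obtain ⟨v₁, W, hv₁, hW, hmod, hhalt, _, hn⟩ := GridValid.exists_width G.connected hv u
    have hflag : gridFlag (G.label v₁) = gridFlag (G.label v) :=
      GridValid.flag_const G.connected hv hv₁ h1
    have hprog : gridProg (G.label u) = gridProg (G.label v) :=
      GridValid.prog_const G.connected hv u v
    have hpos : 1 ≤ gridDepth (G.label u) := (hv u).depth_pos
    rw [gridHeight, if_pos ⟨rfl, hflag.trans h2⟩] at hn
    -- Written with the extra row apart: `n` has the residue of `W`, which is `1`.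
    have hn' : G.n = W * (gridDepth (G.label u) + 1) + W := by rw [hn]; simp only [id]; ring
    have hmod' : W % (gridDepth (G.label u) + 1) = 1 := hmod
    refine hsize ?_ ?_ ?_
    · nlinarith
    · rw [hn', Nat.mul_add_mod_self_right, hmod']
    · rw [hprog]
      rw [show gridProg (id (G.label u)) = gridProg (G.label v) from hprog] at hhalt
      refine outputWithin_eq_one h3 hhalt ?_
      rw [hn']
      have : 0 ≤ W * (gridDepth (G.label u) + 1) := Nat.zero_le _
      omega

/-! ### Grid graphs -/

section Grid

variable {β : Type}

/-- The grid with `W` columns and `H` rows. -/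
def gridGraph {W H : ℕ} (hW : 0 < W) (hH : 0 < H) (lab : ℕ → ℕ → β) : LabelledGraph β where
  n := W * H
  graph := (SimpleGraph.pathGraph W □ SimpleGraph.pathGraph H).comap finProdFinEquiv.symm
  connected := by
    obtain ⟨w, rfl⟩ : ∃ w, W = w + 1 := ⟨W - 1, by omega⟩
    obtain ⟨h, rfl⟩ : ∃ h, H = h + 1 := ⟨H - 1, by omega⟩
    exact (SimpleGraph.Iso.comap finProdFinEquiv.symm _).connected_iff.2
      ((SimpleGraph.pathGraph_connected w).boxProd (SimpleGraph.pathGraph_connected h))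
  label v := lab (finProdFinEquiv.symm v).1 (finProdFinEquiv.symm v).2

/-- The column of a node. -/
def nodeCol {W H : ℕ} (v : Fin (W * H)) : ℕ := (finProdFinEquiv.symm v).1

/-- The row of a node. -/
def nodeRow {W H : ℕ} (v : Fin (W * H)) : ℕ := (finProdFinEquiv.symm v).2

variable {W H : ℕ}

theorem nodeCol_lt (v : Fin (W * H)) : nodeCol v < W := Fin.isLt _

theorem nodeRow_lt (v : Fin (W * H)) : nodeRow v < H := Fin.isLt _

theorem node_ext {u v : Fin (W * H)} (h1 : nodeCol u = nodeCol v) (h2 : nodeRow u = nodeRow v) :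
    u = v :=
  finProdFinEquiv.symm.injective (Prod.ext (Fin.ext h1) (Fin.ext h2))

theorem exists_node {x y : ℕ} (hx : x < W) (hy : y < H) :
    ∃ v : Fin (W * H), nodeCol v = x ∧ nodeRow v = y :=
  ⟨finProdFinEquiv (⟨x, hx⟩, ⟨y, hy⟩), by simp [nodeCol], by simp [nodeRow]⟩

variable {hW : 0 < W} {hH : 0 < H} {lab : ℕ → ℕ → β}

theorem gridGraph_adj {u v : Fin (W * H)} : (gridGraph hW hH lab).graph.Adj u v ↔
    ((nodeCol u + 1 = nodeCol v ∨ nodeCol v + 1 = nodeCol u) ∧ nodeRow u = nodeRow v) ∨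
    ((nodeRow u + 1 = nodeRow v ∨ nodeRow v + 1 = nodeRow u) ∧ nodeCol u = nodeCol v) := by
  unfold gridGraph
  simp only [SimpleGraph.comap_adj, SimpleGraph.boxProd_adj, SimpleGraph.pathGraph_adj,
    Fin.ext_iff]
  rfl

theorem gridGraph_dist {v u : Fin (W * H)} {k : ℕ}
    (h : (gridGraph hW hH lab).graph.dist v u ≤ k) :
    (nodeCol u ≤ nodeCol v + k ∧ nodeCol v ≤ nodeCol u + k) ∧
      nodeRow u ≤ nodeRow v + k ∧ nodeRow v ≤ nodeRow u + k := by
  induction k generalizing u with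
  | zero =>
    have : v = u := (gridGraph hW hH lab).connected.dist_eq_zero_iff.1 (by omega)
    subst this
    simp
  | succ k ih =>
    rcases LabelledGraph.exists_adj_of_dist_le_succ _ h with rfl | ⟨w, hw, hwu⟩
    · simp
    · have := ih hw
      have hadj := (gridGraph_adj (hW := hW) (hH := hH) (lab := lab) (u := w) (v := u)).1 hwu
      omega

/-- Nodes of two grids at which the grids look alike have the same output. -/
theorem gridGraph_out_eq [Primcodable β] {A : LocalAlgorithm β} (hA : A.IdentifierOblivious)
    {W' H' : ℕ} {hW' : 0 < W'} {hH' : 0 < H'} {lab' : ℕ → ℕ → β}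
    (ids : Fin (gridGraph hW hH lab).n ↪ ℕ) (ids' : Fin (gridGraph hW' hH' lab').n ↪ ℕ)
    {v : Fin (W * H)} {v' : Fin (W' * H')} (hrow : nodeRow v = nodeRow v')
    (hleft : min (nodeCol v) A.radius = min (nodeCol v') A.radius)
    (hright : min (W - 1 - nodeCol v) A.radius = min (W' - 1 - nodeCol v') A.radius)
    (hheight : ∀ y, y ≤ nodeRow v + A.radius → (y < H ↔ y < H'))
    (hlab : ∀ x x' y, x + nodeCol v' = x' + nodeCol v → y ≤ nodeRow v + A.radius →
      nodeRow v ≤ y + A.radius → lab x y = lab' x' y) :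
    A.out ((gridGraph hW hH lab).view ids A.radius v)
      = A.out ((gridGraph hW' hH' lab').view ids' A.radius v') := by
  -- The isomorphism is a translation of columns on the square box around the centres, which
  -- contains the balls. Equality of the truncated distances to both ends guarantees that translated
  -- nodes exist.
  refine LabelledGraph.BallIso.out_eq hA (E := fun (u : Fin (W * H)) (u' : Fin (W' * H')) =>
    nodeCol u + nodeCol v' = nodeCol u' + nodeCol v ∧ nodeRow u = nodeRow u' ∧
    (nodeCol u ≤ nodeCol v + A.radius ∧ nodeCol v ≤ nodeCol u + A.radius) ∧
    nodeRow u ≤ nodeRow v + A.radius ∧ nodeRow v ≤ nodeRow u + A.radius) ?_ ids ids'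
  have hv := nodeCol_lt v
  have hv' := nodeCol_lt v'
  constructor
  · omega
  · intro u u' u'' h1 h2
    exact node_ext (by omega) (by omega)
  · intro u w u' h1 h2
    exact node_ext (by omega) (by omega)
  · intro u u' w w' h1 h2
    refine (gridGraph_adj (hW := hW) (hH := hH) (lab := lab) (u := u) (v := w)).trans
      (Iff.trans ?_ (gridGraph_adj (hW := hW') (hH := hH') (lab := lab') (u := u') (v := w')).symm)
    omega
  · intro u u' h
    have h1 := hlab (nodeCol u) (nodeCol u') (nodeRow u) h.1 h.2.2.2.1 h.2.2.2.2
    exact h1.trans (congrArg (lab' (nodeCol u')) h.2.1)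
  · intro u hu
    have h := gridGraph_dist hu
    have hc := nodeCol_lt u
    have hr := (hheight (nodeRow u) h.2.1).1 (nodeRow_lt u)
    obtain ⟨u', h1, h2⟩ := exists_node (W := W') (H := H') (x := nodeCol u + nodeCol v' - nodeCol v)
      (y := nodeRow u) (by omega) hr
    exact ⟨u', by omega, h2.symm, h⟩
  · intro u' hu'
    have h := gridGraph_dist hu'
    have hc := nodeCol_lt u'
    have hr := (hheight (nodeRow u') (by omega)).2 (nodeRow_lt u')
    obtain ⟨u, h1, h2⟩ := exists_node (W := W) (H := H) (x := nodeCol u' + nodeCol v - nodeCol v')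
      (y := nodeRow u') (by omega) hr
    exact ⟨u, by omega, h2, by omega, by omega⟩

end Grid

/-! ### The instances of the grid languages -/

/-- The labels of a grid for the program `N`, with depth `r` and flag `b`. -/
def instanceLabel (N r b x y : ℕ) : List Bool :=
  gridLabel (N, r, y, if r ≤ y then b else 0, if y = 0 then x else 0)

theorem primrec_instanceLabel (r b x y : ℕ) : Primrec fun N => instanceLabel N r b x y :=
  primrec_gridLabel.comp (.pair .id (.const _))

theorem gridHeight_pos (p : Bool) (r b : ℕ) : 0 < gridHeight p r b := by
  unfold gridHeight; omega

/-- The grid for the program `N`, with depth `r`, flag `b` and `W` columns. -/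
def gridInstance (p : Bool) (N r b : ℕ) {W : ℕ} (hW : 0 < W) : LabelledGraph (List Bool) :=
  gridGraph hW (gridHeight_pos p r b) (instanceLabel N r b)

theorem GridValid.congr {V : Type} {G : SimpleGraph V} {N r i b d N' r' i' b' d' : V → ℕ}
    {p : Bool} (hN : ∀ u, N u = N' u) (hr : ∀ u, r u = r' u) (hi : ∀ u, i u = i' u)
    (hb : ∀ u, b u = b' u) (hd : ∀ u, d u = d' u) {v : V} (h : GridValid p G N r i b d v) :
    GridValid p G N' r' i' b' d' v := by
  obtain rfl := funext hN
  obtain rfl := funext hr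
  obtain rfl := funext hi
  obtain rfl := funext hb
  obtain rfl := funext hd
  exact h

section Instance

variable {p : Bool} {N r b W : ℕ} {hW : 0 < W}

/-- With adjacency given in coordinates, the clauses become arithmetic; for `lift` the required node
is the fourth corner of a unit square. -/
theorem gridValid_of_adj {G : SimpleGraph (Fin (W * gridHeight p r b))}
    (eadj : ∀ u v, G.Adj u v ↔
      ((nodeCol u + 1 = nodeCol v ∨ nodeCol v + 1 = nodeCol u) ∧ nodeRow u = nodeRow v) ∨
      ((nodeRow u + 1 = nodeRow v ∨ nodeRow v + 1 = nodeRow u) ∧ nodeCol u = nodeCol v))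
    (hr : 1 ≤ r) (hmod : W % (r + 1) = 1) (hhalt : (outputWithin N (W - 1)).isSome = true)
    (v : Fin (W * gridHeight p r b)) :
    GridValid p G (fun _ => N) (fun _ => r) nodeRow (fun u => if r ≤ nodeRow u then b else 0)
      (fun u => if nodeRow u = 0 then nodeCol u else 0) v := by
  have hheight : gridHeight p r b = r + 1 + if p = true ∧ b = 1 then 1 else 0 := rfl
  have hrow := nodeRow_lt v
  have hcol := nodeCol_lt v
  have hW : 0 < W := by omega
  constructor
  · exact hr
  · by_cases hle : nodeRow v ≤ r
    · exact .inl hle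
    · by_cases hpb : p = true ∧ b = 1
      · rw [if_pos hpb] at hheight
        exact .inr ⟨by omega, hpb.1, by rw [if_pos (by omega)]; exact hpb.2⟩
      · rw [if_neg hpb] at hheight
        omega
  · exact fun _ _ => rfl
  · exact fun _ _ => rfl
  · intro w hw
    rw [eadj] at hw
    omega
  · intro w hw h1 h2
    rw [if_pos h1, if_pos h2]
  · intro w hw w' hw' h1 h2
    rw [eadj] at hw hw'
    exact node_ext (by omega) (by omega)
  · intro h
    obtain ⟨u, h1, h2⟩ := exists_node (W := W) (H := gridHeight p r b) (x := nodeCol v)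
      (y := nodeRow v - 1) hcol (by omega)
    exact ⟨u, (eadj v u).2 (by omega), by omega⟩
  · intro h
    have : nodeRow v + 1 < gridHeight p r b := by
      rcases h with h | ⟨h1, h2, h3⟩
      · omega
      · rw [if_pos h1.ge] at h3
        rw [if_pos ⟨h2, h3⟩] at hheight
        omega
    obtain ⟨u, h1, h2⟩ := exists_node (W := W) (H := gridHeight p r b) (x := nodeCol v)
      (y := nodeRow v + 1) hcol this
    exact ⟨u, (eadj v u).2 (by omega), by omega⟩
  · intro w hw h1 u hu h2
    rw [eadj] at hw hu
    obtain ⟨u', h3, h4⟩ := exists_node (W := W) (H := gridHeight p r b) (x := nodeCol w)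
      (y := nodeRow u) (nodeCol_lt w) (nodeRow_lt u)
    exact ⟨u', (eadj w u').2 (by omega), h4, (eadj u u').2 (by omega)⟩
  · intro h w hw h'
    rw [eadj] at hw
    rw [if_pos h, if_pos h']
    omega
  · intro h w hw w' hw' h1 h2
    rw [if_pos h1, if_pos h2]
    exact fun h3 => node_ext h3 (by omega)
  · rw [imp_iff_not_or]
    by_cases h : nodeRow v = 0
    · right
      rw [if_pos h]
      intro h'
      obtain ⟨u, h1, h2⟩ := exists_node (W := W) (H := gridHeight p r b) (x := nodeCol v - 1)
        (y := 0) (by omega) (by omega)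
      exact ⟨u, (eadj v u).2 (by omega), h2, by rw [if_pos h2]; omega⟩
    · exact .inl h
  · intro h
    rw [if_pos h]
    by_cases hlast : nodeCol v + 1 < W
    · left
      obtain ⟨u, h1, h2⟩ := exists_node (W := W) (H := gridHeight p r b) (x := nodeCol v + 1)
        (y := 0) hlast (by omega)
      exact ⟨u, (eadj v u).2 (by omega), h2, by rw [if_pos h2]; omega⟩
    · right
      obtain h' : nodeCol v = W - 1 := by omega
      rw [h']
      exact ⟨by rw [Nat.sub_add_cancel hW]; exact hmod, hhalt⟩

theorem gridInstance_label (v : Fin (W * gridHeight p r b)) :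
    (gridInstance p N r b hW).label v = gridLabel (N, r, nodeRow v,
      if r ≤ nodeRow v then b else 0, if nodeRow v = 0 then nodeCol v else 0) := rfl

theorem gridInstance_prog (v : Fin (W * gridHeight p r b)) :
    gridProg ((gridInstance p N r b hW).label v) = N := by
  rw [gridInstance_label, gridProg, gridData_gridLabel]

theorem gridInstance_depth (v : Fin (W * gridHeight p r b)) :
    gridDepth ((gridInstance p N r b hW).label v) = r := by
  rw [gridInstance_label, gridDepth, gridData_gridLabel]

theorem gridInstance_row (v : Fin (W * gridHeight p r b)) :
    gridRow ((gridInstance p N r b hW).label v) = nodeRow v := by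
  rw [gridInstance_label, gridRow, gridData_gridLabel]

theorem gridInstance_flag (v : Fin (W * gridHeight p r b)) :
    gridFlag ((gridInstance p N r b hW).label v) = if r ≤ nodeRow v then b else 0 := by
  rw [gridInstance_label, gridFlag, gridData_gridLabel]

theorem gridInstance_col (v : Fin (W * gridHeight p r b)) :
    gridCol ((gridInstance p N r b hW).label v) = if nodeRow v = 0 then nodeCol v else 0 := by
  rw [gridInstance_label, gridCol, gridData_gridLabel]

theorem gridInstance_isGridAt (hr : 1 ≤ r) (hmod : W % (r + 1) = 1)
    (hhalt : (outputWithin N (W - 1)).isSome = true) (v : Fin (W * gridHeight p r b)) :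
    (gridInstance p N r b hW).IsGridAt p id v :=
  (gridValid_of_adj (G := (gridInstance p N r b hW).graph)
    (fun _ _ => gridGraph_adj (hW := hW) (lab := instanceLabel N r b)) hr hmod hhalt v).congr
    (fun u => (gridInstance_prog u).symm) (fun u => (gridInstance_depth u).symm)
    (fun u => (gridInstance_row u).symm) (fun u => (gridInstance_flag u).symm)
    (fun u => (gridInstance_col u).symm)

theorem gridInstance_mem_iff (hr : 1 ≤ r) (hmod : W % (r + 1) = 1)
    (hhalt : (outputWithin N (W - 1)).isSome = true) :
    gridInstance p N r b hW ∈ gridLanguage p ↔ ¬ (b = 1 ∧ HasOutput N 1) := by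
  constructor
  · rintro ⟨_, h⟩ ⟨hb, hN⟩
    obtain ⟨v, _, hv⟩ := exists_node (W := W) (H := gridHeight p r b) (x := 0) (y := r) hW
      (by unfold gridHeight; omega)
    refine h ⟨v, ?_, ?_, ?_⟩
    · exact (gridInstance_depth v).le.trans (hv.symm.trans (gridInstance_row v).symm).le
    · exact (gridInstance_flag v).trans (by rw [if_pos hv.ge, hb])
    · exact (gridInstance_prog (p := p) (N := N) (b := b) (hW := hW) v).symm ▸ hN
  · intro h
    refine ⟨gridInstance_isGridAt hr hmod hhalt, ?_⟩
    rintro ⟨v, h1, h2, h3⟩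
    have e1 : r ≤ nodeRow v := (gridInstance_depth v).symm.le.trans (h1.trans
      (gridInstance_row v).le)
    have e2 := (gridInstance_flag v).symm.trans h2
    rw [if_pos e1] at e2
    have e3 := gridInstance_prog (p := p) (N := N) (b := b) (hW := hW) v
    exact h ⟨e2, e3 ▸ h3⟩

end Instance

/-! ### The views of grids as functions of the labels -/

theorem Primrec.list_map_const {γ ι β : Type} [Primcodable γ] [Primcodable β] (l : List ι)
    {f : ι → γ → β} (hf : ∀ i, Primrec (f i)) : Primrec fun c => l.map fun i => f i c := by
  induction l with
  | nil => exact .const []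
  | cons a l ih => exact Primrec.list_cons.comp (hf a) ih

theorem Computable.list_all_const {γ ι : Type} [Primcodable γ] (l : List ι)
    {f : ι → γ → Bool} (hf : ∀ i, Computable (f i)) :
    Computable fun c => l.all fun i => f i c := by
  induction l with
  | nil => exact .const true
  | cons a l ih => exact Primrec.and.to_comp.comp (hf a) ih

/-- The graph and the identifiers are fixed and only the labels depend on `N`, so the view is a list
of fixed shape with primitive recursive entries. -/
theorem primrec_gridGraph_view {β : Type} [Primcodable β] {W H : ℕ} (hW : 0 < W) (hH : 0 < H)
    {lab : ℕ → ℕ → ℕ → β} (hlab : ∀ x y, Primrec fun N => lab N x y) (ids : Fin (W * H) ↪ ℕ)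
    (r : ℕ) (v : Fin (W * H)) :
    Primrec fun N => (gridGraph hW hH (lab N)).view ids r v := by
  classical
  let G : LabelledGraph Unit := gridGraph hW hH fun _ _ => ()
  let nb : Fin (W * H) → List ℕ := fun u =>
    ((G.ball ids r v).filter fun w => decide (G.graph.Adj u w)).map ids
  have h : ∀ N, (gridGraph hW hH (lab N)).view ids r v = (ids v, (G.ball ids r v).map
      fun u : Fin (W * H) => (ids u, lab N (nodeCol u) (nodeRow u), nb u)) := fun N => rfl
  refine (Primrec.pair (.const (ids v)) (Primrec.list_map_const (G.ball ids r v)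
    (f := fun (u : Fin (W * H)) N => (ids u, lab N (nodeCol u) (nodeRow u), nb u))
    fun u => ?_)).of_eq fun N => (h N).symm
  exact .pair (.const _) (.pair (hlab _ _) (.const _))

/-! ### The lower bound -/

/-- The programs with output `0` and those with output `1` are computably inseparable. -/
theorem not_computable_separating {χ : ℕ → Bool} (hχ : Computable χ)
    (h : ∀ N, HasOutput N 0 ∨ HasOutput N 1 → (χ N = true ↔ ¬ HasOutput N 1)) : False := by
  -- A fixed point of `f` is a program that asks `χ` about itself and does the opposite: it outputs
  -- `1` exactly if `χ` denies the output `1`.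
  let f : Nat.Partrec.Code → ℕ →. ℕ := fun c _ => Part.some (cond (χ (Encodable.encode c)) 1 0)
  have hf : Partrec₂ f :=
    Computable.partrec (Computable.cond (hχ.comp (Computable.encode.comp .fst))
      (.const 1) (.const 0))
  obtain ⟨c, hc⟩ := Nat.Partrec.Code.fixed_point₂ hf
  have hout : ∀ y, HasOutput (Encodable.encode c) y ↔
      y = cond (χ (Encodable.encode c)) 1 0 := by
    intro y
    unfold HasOutput
    rw [Denumerable.ofNat_encode, hc]
    simp [f]
  have := h (Encodable.encode c)
  rw [hout, hout] at this
  cases hb : χ (Encodable.encode c) <;> simp [hb] at this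

/-- An identifier-oblivious algorithm cannot tell the instances of the grid languages with output
`0` from those with output `1`, even if the nodes of row `0` have additional labels that do not
depend on the flag. -/
theorem not_oblivious_grid {β : Type} [Primcodable β] {A : LocalAlgorithm β}
    (hA : A.IdentifierOblivious) {r : ℕ} (hr : r = 2 * A.radius + 1) {cc : List Bool → β}
    (hcc : Primrec cc) (p : Bool) {lb : ℕ → ℕ → ℕ → ℕ → ℕ → β}
    (hlb : ∀ N b W x y, 1 ≤ y → lb N b W x y = cc (instanceLabel N r b x y))
    (hlb0 : ∀ N W x, lb N 0 W x 0 = lb N 1 W x 0)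
    (hdec : ∀ N b W (hW : 0 < W), W % (r + 1) = 1 → (outputWithin N (W - 1)).isSome = true →
      ∀ ids : Fin (W * gridHeight p r b) ↪ ℕ,
        (A.Accepts (gridGraph hW (gridHeight_pos p r b) (lb N b W)) ids ↔
          ¬ (b = 1 ∧ HasOutput N 1))) : False := by
  have hW₀ : 0 < 2 * A.radius + 1 := by omega
  -- With this width every combination of truncated distances to the two ends that occurs in a wider
  -- grid occurs here too, the middle column standing for all interior ones.
  let W₀ := 2 * A.radius + 1
  let H := gridHeight p r 1
  let Q : ℕ → LabelledGraph β := fun N =>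
    gridGraph hW₀ (gridHeight_pos p r 1) fun x y => cc (instanceLabel N r 1 x y)
  let top : List (Fin (W₀ * H)) :=
    (List.finRange _).filter fun v => decide (r ≤ nodeRow v + A.radius)
  -- Only the outputs near the top of the small grid are consulted. The small grid need not be a
  -- valid instance.
  let χ : ℕ → Bool := fun N => top.all fun v =>
    A.out (LabelledGraph.view (Q N) Fin.valEmbedding A.radius v)
  have hχ : Computable χ := by
    refine Computable.list_all_const top fun v => A.computable.comp (Primrec.to_comp ?_)
    exact primrec_gridGraph_view (lab := fun N x y => cc (instanceLabel N r 1 x y)) hW₀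
      (gridHeight_pos p r 1) (fun x y => hcc.comp (primrec_instanceLabel r 1 x y)) Fin.valEmbedding
      A.radius v
  have hχ' : ∀ N, χ N = true ↔ ∀ v : Fin (W₀ * H), r ≤ nodeRow v + A.radius →
      A.out (LabelledGraph.view (Q N) Fin.valEmbedding A.radius v) = true := by
    intro N
    simp only [χ, top, List.all_eq_true, List.mem_filter, List.mem_finRange, true_and,
      decide_eq_true_eq]
  refine not_computable_separating hχ fun N hN => ?_
  obtain ⟨k, hk⟩ : ∃ k, (outputWithin N k).isSome = true := by
    rcases hN with h | h <;> obtain ⟨k, hk⟩ := hasOutput_iff.1 h <;> exact ⟨k, by rw [hk]; rfl⟩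
  obtain ⟨W, hW, hWW, hmod, hhalt⟩ : ∃ W, 0 < W ∧ W₀ ≤ W ∧ W % (r + 1) = 1 ∧
      (outputWithin N (W - 1)).isSome = true := by
    -- This width has residue `1`, is at least `W₀`, and leaves at least `k` steps for the program.
    refine ⟨(k + W₀) * (r + 1) + 1, by omega, ?_, ?_, ?_⟩
    · nlinarith
    · rw [Nat.mul_add_mod_self_right]
      exact Nat.mod_eq_of_lt (by omega)
    · obtain ⟨y, hy⟩ := Option.isSome_iff_exists.1 hk
      rw [outputWithin_mono (k' := (k + W₀) * (r + 1) + 1 - 1) (by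
        rw [Nat.add_sub_cancel]; nlinarith) hy]
      rfl
  have hd1 := hdec N 1 W hW hmod hhalt Fin.valEmbedding
  -- The instance with flag `0` is accepted whatever `N` outputs; it vouches for all nodes that do
  -- not see the flag.
  have hd0 := (hdec N 0 W hW hmod hhalt Fin.valEmbedding).2 (by simp)
  -- the same output at nodes with the same distances to the ends, if these are short
  have htop : ∀ (v : Fin (W * H)) (v' : Fin (W₀ * H)), r ≤ nodeRow v + A.radius →
      nodeRow v = nodeRow v' → min (nodeCol v) A.radius = min (nodeCol v') A.radius →
      min (W - 1 - nodeCol v) A.radius = min (W₀ - 1 - nodeCol v') A.radius →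
      A.out ((gridGraph hW (gridHeight_pos p r 1) (lb N 1 W)).view Fin.valEmbedding A.radius v)
        = A.out (LabelledGraph.view (Q N) Fin.valEmbedding A.radius v') := by
    intro v v' h1 h2 h3 h4
    refine gridGraph_out_eq hA _ _ h2 h3 h4 (fun _ _ => Iff.rfl) ?_
    intro x x' y _ _ hy
    -- Here `r = 2 * A.radius + 1` is used: a node within `A.radius` of row `r` sees no node of row
    -- `0`, hence no column number and no exceptional label.
    have hy1 : y ≠ 0 := by omega
    rw [hlb _ _ _ _ _ (by omega), instanceLabel, instanceLabel, if_neg hy1, if_neg hy1]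
  rw [hχ']
  constructor
  · intro h hone
    refine (hd1.1 ?_) ⟨rfl, hone⟩
    intro (v : Fin (W * H))
    by_cases hv : r ≤ nodeRow v + A.radius
    · have hcol := nodeCol_lt v
      obtain ⟨x, hx, h3, h4⟩ : ∃ x < W₀, min (nodeCol v) A.radius = min x A.radius ∧
          min (W - 1 - nodeCol v) A.radius = min (W₀ - 1 - x) A.radius := by
        by_cases h1 : nodeCol v ≤ A.radius
        · exact ⟨nodeCol v, by omega, by omega, by omega⟩
        · by_cases h2 : W - 1 - nodeCol v ≤ A.radius
          · exact ⟨2 * A.radius - (W - 1 - nodeCol v), by omega, by omega, by omega⟩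
          · exact ⟨A.radius, by omega, by omega, by omega⟩
      obtain ⟨v', h1, h2⟩ := exists_node hx (nodeRow_lt v)
      have := htop v v' hv h2.symm (by rw [h1]; exact h3) (by rw [h1]; exact h4)
      exact this.trans (h v' (by omega))
    -- A lower node sees only rows below `r`, which are the same for both flags, so its output is
    -- that of the same position in the accepted instance.
    · have hlt : nodeRow v < gridHeight p r 0 := by unfold gridHeight; omega
      obtain ⟨u, h1, h2⟩ := exists_node (nodeCol_lt v) hlt
      refine Eq.trans (gridGraph_out_eq hA _ Fin.valEmbedding (v := v) (v' := u) h2.symm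
        (by rw [h1]) (by rw [h1]) ?_ ?_) (hd0 u)
      · intro y hy
        have h1 : r + 1 ≤ gridHeight p r 1 := by unfold gridHeight; omega
        have h0 : r + 1 ≤ gridHeight p r 0 := by unfold gridHeight; omega
        constructor <;> intro <;> omega
      · intro x x' y hx hy _
        have hxx : x = x' := by omega
        subst hxx
        by_cases hy0 : y = 0
        · subst hy0
          exact (hlb0 N W x).symm
        · have hyr : ¬ r ≤ y := by omega
          rw [hlb _ _ _ _ _ (by omega), hlb _ _ _ _ _ (by omega), instanceLabel, instanceLabel,
            if_neg hyr, if_neg hyr]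
  · intro hone v' hv'
    have hcol := nodeCol_lt v'
    -- Conversely, every column of the small grid is found near the left or the right end of the
    -- wide one.
    obtain ⟨x, hx, h3, h4⟩ : ∃ x < W, min x A.radius = min (nodeCol v') A.radius ∧
        min (W - 1 - x) A.radius = min (W₀ - 1 - nodeCol v') A.radius := by
      by_cases h1 : nodeCol v' ≤ A.radius
      · exact ⟨nodeCol v', by omega, by omega, by omega⟩
      · exact ⟨W - 1 - (2 * A.radius - nodeCol v'), by omega, by omega, by omega⟩
    obtain ⟨v, h1, h2⟩ := exists_node hx (nodeRow_lt v')
    have := htop v v' (by omega) h2 (by rw [h1]; exact h3) (by rw [h1]; exact h4)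
    exact this.symm.trans (hd1.2 (fun h => hone h.2) v)

/-! ### The two grid languages against oblivious algorithms -/

theorem gridLanguage_notMem_LDO : gridLanguage true ∉ LDO := by
  rintro ⟨A, hA, hdec⟩
  refine not_oblivious_grid hA rfl (cc := id) Primrec.id true
    (lb := fun N b _ => instanceLabel N (2 * A.radius + 1) b) (fun _ _ _ _ _ _ => rfl) ?_ ?_
  · intro N _ x
    simp [instanceLabel]
  · intro N b W hW hmod hhalt ids
    exact (hdec _ _).symm.trans (gridInstance_mem_iff (hW := hW) (by omega) hmod hhalt)

/-- Without the extra row the size, and so the string `b_n`, is the same for both flags. Placed in a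
corner of row `0`, it is one of the additional labels admitted by `not_oblivious_grid`. -/
theorem gridLanguage_notMem_LDOWith : gridLanguage false ∉ LDOWith haltingOracle := by
  rintro ⟨A, hA, hdec⟩
  have hheight : ∀ r b, gridHeight false r b = r + 1 := fun r b => by simp [gridHeight]
  refine not_oblivious_grid hA rfl (cc := fun x => (x, [false]))
    (Primrec.pair .id (.const _)) false
    (lb := fun N b W x y => (instanceLabel N (2 * A.radius + 1) b x y,
      if x = 0 ∧ y = 0 then haltingBits (W * gridHeight false (2 * A.radius + 1) b)
        else [false])) ?_ ?_ ?_
  · intro N b W x y hy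
    rw [if_neg (by omega)]
  · intro N W x
    simp [instanceLabel, hheight]
  · intro N b W hW hmod hhalt
    obtain ⟨v₀, hx, hy⟩ := exists_node hW (gridHeight_pos false (2 * A.radius + 1) b)
    have hn : 1 < W * gridHeight false (2 * A.radius + 1) b := by rw [hheight]; nlinarith
    let last : Fin (W * gridHeight false (2 * A.radius + 1) b) := ⟨_, Nat.sub_one_lt_of_lt hn⟩
    -- The adversarial assignment: the last oracle label goes to the corner `v₀`, and all other
    -- nodes get `[false]`.
    let π : Equiv.Perm (Fin (W * gridHeight false (2 * A.radius + 1) b)) := Equiv.swap v₀ last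
    have hG : (gridInstance false N (2 * A.radius + 1) b hW).withOracle haltingOracle π =
        gridGraph hW (gridHeight_pos false (2 * A.radius + 1) b) fun x y =>
          (instanceLabel N (2 * A.radius + 1) b x y,
            if x = 0 ∧ y = 0 then haltingBits (W * gridHeight false (2 * A.radius + 1) b)
              else [false]) := by
      have hlab : ∀ v, haltingOracle.label _ (π v) = if nodeCol v = 0 ∧ nodeRow v = 0 then
          haltingBits (W * gridHeight false (2 * A.radius + 1) b) else [false] := by
        intro v
        split_ifs with h
        · obtain rfl : v = v₀ := node_ext (by omega) (by omega)
          apply haltingOracle_label_of_eq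
          simp only [π, Equiv.swap_apply_left, last]
          omega
        · apply haltingOracle_label_of_lt
          intro hlast
          refine h ?_
          have h1 : π v = last := Fin.ext (by simp only [last]; omega)
          have h2 : π v = π v₀ := by rw [h1]; exact (Equiv.swap_apply_left _ _).symm
          rw [π.injective h2]
          exact ⟨hx, hy⟩
      unfold LabelledGraph.withOracle
      congr 1
      funext v
      exact Prod.ext rfl (hlab v)
    -- The type of the identifiers depends on the graph, so the equality `hG` is used through a
    -- variable `G'`.
    have key : ∀ G', (gridInstance false N (2 * A.radius + 1) b hW).withOracle haltingOracle π = G' →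
        ∀ ids : Fin G'.n ↪ ℕ, A.Accepts G' ids ↔ ¬ (b = 1 ∧ HasOutput N 1) := by
      rintro _ rfl ids
      exact (hdec _ π ids).symm.trans (gridInstance_mem_iff (hW := hW) (by omega) hmod hhalt)
    exact key _ hG

theorem theorem5 :
    haltingOracle.Small ∧
    (haltingPaths ∈ LDOWith haltingOracle ∧ haltingPaths ∉ LD) ∧
    (∃ L₂ : DistributedLanguage, L₂ ∈ LD ∧ L₂ ∈ LDOWith haltingOracle ∧ L₂ ∉ LDO) ∧
    (∃ L₃ : DistributedLanguage, L₃ ∈ LD ∧ L₃ ∉ LDOWith haltingOracle) ∧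
    ¬ LD ⊆ LDOWith haltingOracle ∧ ¬ LDOWith haltingOracle ⊆ LD :=
  ⟨haltingOracle_small, ⟨haltingPaths_mem_LDOWith, haltingPaths_notMem_LD⟩,
    ⟨gridLanguage true, gridLanguage_mem_LD true, gridLanguage_mem_LDOWith,
      gridLanguage_notMem_LDO⟩,
    ⟨gridLanguage false, gridLanguage_mem_LD false, gridLanguage_notMem_LDOWith⟩,
    fun h => gridLanguage_notMem_LDOWith (h (gridLanguage_mem_LD false)),
    fun h => haltingPaths_notMem_LD (h haltingPaths_mem_LDOWith)⟩
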